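/- For every sample size $n$ let $\boldsymbol X=(X_1,\dots,X_{p_n})$ be a random vector, let $\varepsilon$ be a random noise independent of $\boldsymbol X$ with $\mathbb E\,\varepsilon=0$ and $\operatorname{Var}(\varepsilon)=\sigma^2<\infty$ ($\sigma$ is known and does not depend on $n$), and let $Y=\mu_n(\boldsymbol X)+\varepsilon$ with a measurable, possibly nonlinear function $\mu_n$ such that $\mathbb E\,\mu_n(\boldsymbol X)=0$. The data are $n$ independent copies $z_i=(\boldsymbol X_i,Y_i)$ of $z=(\boldsymbol X,Y)$. The model class $\mathcal M_n$ is a non-empty set of subsets $\alpha\subseteq\{1,\dots,p_n\}$; the model $\alpha$ has the loss $$\ell(z,\theta;\alpha)=\Bigl(y-\sum_{j\in\alpha}\theta_jx_j\Bigr)^2-\sigma^2,\qquad \theta\in\mathcal H_n[\alpha]\subset\mathbb R^{\alpha}.$$ Write $E_nf=n^{-1}\sum_{i=1}^nf(z_i)$. Let $\hat\theta_n[\alpha]$ be a (measurable) minimizer of $\theta\mapsto E_n\ell(\cdot,\theta;\alpha)$ over $\mathcal H_n[\alpha]$, let $\mathcal L_n[\alpha]=\mathbb E_*\ell(\cdot,\hat\theta_n[\alpha];\alpha)$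 be its out-sample prediction loss (expectation over a future observation, given the data) and $\mathcal R_n[\alpha]=\mathbb E\,\mathcal L_n[\alpha]$ its risk (expectation over the data). The GTIC procedure selects a model $\hat\alpha_n\in\mathcal M_n$ that minimizes $$E_n\ell(\cdot,\hat\theta_n[\alpha];\alpha)+n^{-1}\operatorname{tr}\bigl\{\hat V_n(\hat\theta_n[\alpha];\alpha)^{-1}\hat J_n(\hat\theta_n[\alpha];\alpha)\bigr\},\qquad \hat V_n=E_n\nabla_\theta^2\ell,\quad \hat J_n=E_n\{\nabla_\theta\ell\,(\nabla_\theta\ell)^{\mathrm T}\}$$ (the trace term is read as $0$ if $\hat V_n$ is singular). Suppose that there are constants $c$, $K$, not depending on $n$, such that $|\mu_n(\boldsymbol X)|\le c$ and $|X_j|\le c$ almost surely for $j=1,\dots,p_n$, and such that the parameter spaces are compact with $\{\|\theta\|\le c\}\subseteq\mathcal H_n[\alpha]\subseteq\{\|\theta\|\le K\sqrt{p_n}\}$ for all $n$ and $\alpha\in\mathcal M_n$ (for example $\mathcal H_n[\alpha]=\{\|\theta\|\le 2c\sqrt{p_n}\}$). Suppose moreover that 1. $X_1,\dots,X_{p_n}$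 are independent with zero mean and unit variance, for all $n$; 2. $p_n=o(n^w)$, where $w<1/8$; 3. $\inf_{\alpha\in\mathcal M_n}\mathcal R_n[\alpha]>n^{-\zeta}$ for all large $n$, where $\zeta<1-2w$; 4. $\operatorname{card}(\mathcal M_n)=O(n^\nu)$, where $\nu<1/2-4w$. Then GTIC is asymptotically efficient: $$\frac{\mathcal L_n[\hat\alpha_n]}{\min_{\alpha\in\mathcal M_n}\mathcal L_n[\alpha]}\longrightarrow 1\quad\text{in probability as } n\to\infty.$$ -/

import Mathlib

open MeasureTheory ProbabilityTheory Filter Topology Asymptotics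

namespace GTIC

/-- The empirical mean `E_n f = n⁻¹ ∑ f (z_i)` of a real, vector or matrix valued function. -/
noncomputable def empMean {Z E : Type*} [AddCommGroup E] [Module ℝ E] {n : ℕ}
    (z : Fin n → Z) (f : Z → E) : E :=
  (n : ℝ)⁻¹ • ∑ i, f (z i)

/-- `θ` minimizes the empirical loss over the parameter space `H` (minimum loss estimator). -/
def IsMinLossEstimator {Z Θ : Type*} {n : ℕ} (l : Z → Θ → ℝ) (H : Set Θ) (z : Fin n → Z)
    (θ : Θ) : Prop :=
  θ ∈ H ∧ ∀ θ' ∈ H, empMean z (fun x => l x θ) ≤ empMean z (fun x => l x θ')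

/-- The expected loss of the parameter `θ` at a future observation with law `D`; with the
minimum loss estimator for `θ` it is the out-sample prediction loss. -/
noncomputable def predLoss {Z Θ : Type*} [MeasurableSpace Z] (D : Measure Z) (l : Z → Θ → ℝ)
    (θ : Θ) : ℝ :=
  ∫ z, l z θ ∂D

/-- The gradient `ψ(z, θ)` of the loss in the parameter. -/
noncomputable def score {Z ι : Type*} [Fintype ι] (l : Z → EuclideanSpace ℝ ι → ℝ) (z : Z)
    (θ : EuclideanSpace ℝ ι) : EuclideanSpace ℝ ι :=
  gradient (l z) θ

/-- The Hessian matrix of the loss in the parameter: entry `(j, k)` is the derivative of the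
`j`-th coordinate of the gradient in the `k`-th direction. -/
noncomputable def hessian {Z ι : Type*} [Fintype ι] [DecidableEq ι]
    (l : Z → EuclideanSpace ℝ ι → ℝ) (z : Z) (θ : EuclideanSpace ℝ ι) : Matrix ι ι ℝ :=
  Matrix.of fun j k => (fderiv ℝ (score l z) θ (EuclideanSpace.single k 1)) j

/-- `V̂_n(θ) = E_n ∇²l(·, θ)`. -/
noncomputable def Vhat {Z ι : Type*} [Fintype ι] [DecidableEq ι] {n : ℕ}
    (l : Z → EuclideanSpace ℝ ι → ℝ) (z : Fin n → Z) (θ : EuclideanSpace ℝ ι) : Matrix ι ι ℝ :=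
  empMean z fun x => hessian l x θ

/-- `Ĵ_n(θ) = E_n (ψ(·, θ) ψ(·, θ)ᵀ)`. -/
noncomputable def Jhat {Z ι : Type*} [Fintype ι] {n : ℕ}
    (l : Z → EuclideanSpace ℝ ι → ℝ) (z : Fin n → Z) (θ : EuclideanSpace ℝ ι) : Matrix ι ι ℝ :=
  empMean z fun x => Matrix.vecMulVec (fun j => score l x θ j) (fun j => score l x θ j)

/-- The corrected prediction loss: the in-sample loss at `θ` plus the penalty
`n⁻¹ tr (V̂_n(θ)⁻¹ Ĵ_n(θ))`. -/
noncomputable def correctedLoss {Z ι : Type*} [Fintype ι] [DecidableEq ι] {n : ℕ}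
    (l : Z → EuclideanSpace ℝ ι → ℝ) (z : Fin n → Z) (θ : EuclideanSpace ℝ ι) : ℝ :=
  empMean z (fun x => l x θ) + (n : ℝ)⁻¹ * ((Vhat l z θ)⁻¹ * Jhat l z θ).trace

/-- The model `α` minimizes the criterion `crit` over the model class `M`. -/
def IsSelected {A : Type*} (M : Finset A) (crit : A → ℝ) (α : A) : Prop :=
  α ∈ M ∧ ∀ α' ∈ M, crit α ≤ crit α'

/-- Asymptotic efficiency: the out-sample prediction loss `L` of the selected model, divided by
the smallest one in the model class, tends to `1` in probability. -/
def AsymptoticallyEfficient {Ω : Type*} [MeasurableSpace Ω] (P : Measure Ω) {A : ℕ → Type*}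
    (M : ∀ n, Finset (A n)) (hM : ∀ n, (M n).Nonempty) (L : ∀ n, A n → Ω → ℝ)
    (sel : ∀ n, Ω → A n) : Prop :=
  TendstoInMeasure P
    (fun n ω => L n (sel n ω) ω / (M n).inf' (hM n) (fun α => L n α ω)) atTop (fun _ => 1)

/-- An observation `(x, y)`: the covariates and the response. -/
abbrev Obs (p : ℕ) : Type := (Fin p → ℝ) × ℝ

/-- The observation with covariates `x` and noise `e`: the response is `y = μ(x) + e`. -/
def observe {p : ℕ} (μ : (Fin p → ℝ) → ℝ) (xe : (Fin p → ℝ) × ℝ) : Obs p :=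
  (xe.1, μ xe.1 + xe.2)

/-- The law of an observation when covariates (law `PX`) and noise (law `Pε`) are independent. -/
noncomputable def obsLaw {p : ℕ} (μ : (Fin p → ℝ) → ℝ) (PX : Measure (Fin p → ℝ))
    (Pε : Measure ℝ) : Measure (Obs p) :=
  (PX.prod Pε).map (observe μ)

/-- The quadratic loss of the linear model on the covariates in `α`, minus the noise variance. -/
def sqLoss {p : ℕ} (σ : ℝ) (α : Finset (Fin p)) (z : Obs p) (θ : EuclideanSpace ℝ α) : ℝ :=
  (z.2 - ∑ j : α, θ j * z.1 j) ^ 2 - σ ^ 2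

end GTIC

/-! The design is orthonormal, so everything reduces to Euclidean geometry of coefficient vectors.
With `g` the error of the best linear approximation of `μ`, `β` its coefficients and `u = β - θ`
(`θ` extended by zero), the prediction loss is `L = E g² + |u|²` (`predLoss_eq`). The empirical loss
is `E_n ε² - σ²`, which is the same for all models, plus `L`, plus three errors: the fluctuation
`baseErr` of `g² + 2gε`, the linear term `2 u · crossErr`, and the quadratic form of `gramErr` at
`u`.

These errors are small relative to `L`. On a single event, common to all models, Cauchy–Schwarz
bounds each of them by a multiple of `δ L`, provided that `L` is at least a multiple `b` of
`n^(-ζ)`. The penalty is of order `p/n`, hence also at most `δ b` there. So the criterion is `L` up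
to a relative error `5δ` and a common shift (`abs_correctedLoss_sub_le`), and its minimizer almost
minimizes `L` (`abs_ratio_sub_one_le`). The event has probability tending to one by Markov's
inequality applied to second moments, because `p²/n = o(n^(-ζ))` (`measureReal_compl_goodEvent_le`).

The assumption bounds the risk, whereas a pointwise lower bound on `L` is needed. It comes from the
deterministic bound `L ≥ modelMSE` together with an upper bound on the risk
(`integral_predLoss_le`): the estimation error adds only `o(modelMSE) + o(n^(-ζ))`, so `modelMSE ≥
n^(-ζ)/4` eventually. -/

namespace GTIC

/-! ### Empirical means -/

section EmpMean

variable {Z : Type*} {n : ℕ} (z : Fin n → Z)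

theorem empMean_eq (f : Z → ℝ) : empMean z f = (n : ℝ)⁻¹ * ∑ i, f (z i) := rfl

theorem empMean_add (f g : Z → ℝ) :
    empMean z (fun x => f x + g x) = empMean z f + empMean z g := by
  simp only [empMean_eq, Finset.sum_add_distrib, mul_add]

theorem empMean_const_mul (a : ℝ) (f : Z → ℝ) :
    empMean z (fun x => a * f x) = a * empMean z f := by
  simp only [empMean_eq, ← Finset.mul_sum]; ring

theorem empMean_sum {ι : Type*} (s : Finset ι) (f : ι → Z → ℝ) :
    empMean z (fun x => ∑ j ∈ s, f j x) = ∑ j ∈ s, empMean z (f j) := by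
  simp only [empMean_eq]
  rw [Finset.sum_comm, Finset.mul_sum]

theorem empMean_const (hn : n ≠ 0) (a : ℝ) : empMean z (fun _ => a) = a := by
  have : (n : ℝ) ≠ 0 := Nat.cast_ne_zero.mpr hn
  simp [empMean_eq, this]

theorem empMean_mono {f g : Z → ℝ} (h : ∀ i, f (z i) ≤ g (z i)) :
    empMean z f ≤ empMean z g := by
  simp only [empMean_eq]
  gcongr with i
  exact h i

theorem empMean_nonneg {f : Z → ℝ} (h : ∀ i, 0 ≤ f (z i)) : 0 ≤ empMean z f := by
  simp only [empMean_eq]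
  have := Finset.sum_nonneg fun i (_ : i ∈ Finset.univ) => h i
  positivity

end EmpMean

/-! ### Laws, second moments and concentration of empirical means of independent copies. -/

section Sampling

variable {Ω E : Type*} [MeasurableSpace Ω] [MeasurableSpace E] {P : Measure Ω}
  {D : Measure E} {n : ℕ} {W : Fin n → Ω → E}

theorem memLp_comp_hasLaw {f : E → ℝ} {q : ENNReal} {V : Ω → E} (hV : HasLaw V D P)
    (hf : MemLp f q D) : MemLp (fun ω => f (V ω)) q P := by
  have h := hV.map_eq
  rw [← h] at hf
  exact hf.comp_of_map hV.aemeasurable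

theorem integral_comp_hasLaw {f : E → ℝ} {V : Ω → E} (hV : HasLaw V D P)
    (hf : AEStronglyMeasurable f D) : ∫ ω, f (V ω) ∂P = ∫ x, f x ∂D :=
  hV.integral_comp hf

theorem ae_comp_hasLaw {q : E → Prop} {V : Ω → E} (hV : HasLaw V D P)
    (hq : ∀ᵐ x ∂D, q x) : ∀ᵐ ω ∂P, q (V ω) := by
  rw [← hV.map_eq] at hq
  exact ae_of_ae_map hV.aemeasurable hq

theorem integrable_empMean (hW : ∀ i, HasLaw (W i) D P) {f : E → ℝ} (hf : Integrable f D) :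
    Integrable (fun ω => empMean (fun i => W i ω) f) P := by
  simp only [empMean_eq]
  refine Integrable.const_mul (integrable_finsetSum _ fun i _ => ?_) _
  exact memLp_one_iff_integrable.1 (memLp_comp_hasLaw (hW i) (memLp_one_iff_integrable.2 hf))

theorem integral_empMean (hn : n ≠ 0) (hW : ∀ i, HasLaw (W i) D P) {f : E → ℝ}
    (hf : Integrable f D) : ∫ ω, empMean (fun i => W i ω) f ∂P = ∫ x, f x ∂D := by
  have : (n : ℝ) ≠ 0 := Nat.cast_ne_zero.mpr hn
  simp only [empMean_eq]
  rw [integral_const_mul, integral_finsetSum]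
  · simp only [integral_comp_hasLaw (hW _) hf.aestronglyMeasurable]
    simp [this]
  · intro i _
    exact memLp_one_iff_integrable.1 (memLp_comp_hasLaw (hW i) (memLp_one_iff_integrable.2 hf))

theorem memLp_empMean (hW : ∀ i, HasLaw (W i) D P) {f : E → ℝ} (hf : MemLp f 2 D) :
    MemLp (fun ω => empMean (fun i => W i ω) f) 2 P := by
  simp only [empMean_eq]
  exact (memLp_finsetSum _ fun i _ => memLp_comp_hasLaw (hW i) hf).const_mul _

/-- The second moment of the empirical mean of a centred function. -/
theorem integral_empMean_sq [IsProbabilityMeasure P] (hn : n ≠ 0)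
    (hW : ∀ i, HasLaw (W i) D P) (hind : iIndepFun W P) {f : E → ℝ} (hfm : Measurable f)
    (hf : MemLp f 2 D) (h0 : ∫ x, f x ∂D = 0) :
    ∫ ω, (empMean (fun i => W i ω) f) ^ 2 ∂P = (n : ℝ)⁻¹ * ∫ x, f x ^ 2 ∂D := by
  have hn' : (n : ℝ) ≠ 0 := Nat.cast_ne_zero.mpr hn
  have hL : ∀ i, MemLp (fun ω => f (W i ω)) 2 P := fun i => memLp_comp_hasLaw (hW i) hf
  have hm : ∀ i, ∫ ω, f (W i ω) ∂P = 0 := fun i => by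
    rw [integral_comp_hasLaw (hW i) hf.aestronglyMeasurable, h0]
  have hv : ∀ i, Var[fun ω => f (W i ω); P] = ∫ x, f x ^ 2 ∂D := fun i => by
    rw [variance_of_integral_eq_zero (hL i).aestronglyMeasurable.aemeasurable (hm i)]
    exact integral_comp_hasLaw (f := fun x => f x ^ 2) (hW i) (hfm.pow_const 2).aestronglyMeasurable
  have hsum := IndepFun.variance_sum (s := Finset.univ) (X := fun i ω => f (W i ω))
    (fun i _ => hL i)
    (fun i _ j _ hij => (hind.indepFun hij).comp hfm hfm)
  rw [variance_of_integral_eq_zero] at hsum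
  · simp only [Finset.sum_apply, hv, Finset.sum_const, Finset.card_univ, Fintype.card_fin,
      nsmul_eq_mul] at hsum
    simp only [empMean_eq, mul_pow]
    rw [integral_const_mul, hsum]
    field_simp
  · exact (memLp_finsetSum' _ fun i _ => hL i).aestronglyMeasurable.aemeasurable
  · simp only [Finset.sum_apply]
    rw [integral_finsetSum _ fun i _ => (hL i).integrable one_le_two]
    simp [hm]

/-- Hoeffding's inequality for the empirical mean of a bounded centred function. -/
theorem measureReal_abs_empMean_ge_le [IsProbabilityMeasure P] [IsProbabilityMeasure D]
    (hn : n ≠ 0) (hW : ∀ i, HasLaw (W i) D P) (hind : iIndepFun W P) {f : E → ℝ}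
    (hfm : Measurable f) {C : ℝ} (hC : ∀ᵐ x ∂D, |f x| ≤ C) (h0 : ∫ x, f x ∂D = 0) {t : ℝ}
    (ht : 0 ≤ t) :
    P.real {ω | t ≤ |empMean (fun i => W i ω) f|} ≤ 2 * Real.exp (-(n * t ^ 2) / (2 * C ^ 2)) := by
  have hn' : (0 : ℝ) < n := by positivity
  have key : ∀ g : E → ℝ, Measurable g → (∀ᵐ x ∂D, |g x| ≤ C) → ∫ x, g x ∂D = 0 →
      P.real {ω | t ≤ empMean (fun i => W i ω) g} ≤ Real.exp (-(n * t ^ 2) / (2 * C ^ 2)) := by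
    intro g hg hgC hg0
    have hsub : ∀ i ∈ (Finset.univ : Finset (Fin n)), HasSubgaussianMGF (fun ω => g (W i ω))
        ((‖C - -C‖₊ / 2) ^ 2) P := by
      intro i _
      have h := hasSubgaussianMGF_of_mem_Icc (μ := P) (X := fun ω => g (W i ω)) (a := -C) (b := C)
        (hg.comp_aemeasurable (hW i).aemeasurable)
        (ae_comp_hasLaw (q := fun x => g x ∈ Set.Icc (-C) C) (hW i) (hgC.mono fun x hx => abs_le.1 hx))
      rw [integral_comp_hasLaw (hW i) hg.aestronglyMeasurable, hg0] at h
      simpa using h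
    have hi : iIndepFun (fun i ω => g (W i ω)) P := hind.comp (fun _ => g) fun _ => hg
    have := HasSubgaussianMGF.measure_sum_ge_le_of_iIndepFun hi hsub
      (ε := n * t) (by positivity)
    have hset : {ω | t ≤ empMean (fun i => W i ω) g} = {ω | n * t ≤ ∑ i, g (W i ω)} := by
      ext ω
      simp only [Set.mem_ofPred_eq, empMean_eq]
      rw [le_inv_mul_iff₀ hn']
    rw [hset]
    refine this.trans (le_of_eq ?_)
    congr 1
    simp only [Finset.sum_const, Finset.card_univ, Fintype.card_fin, nsmul_eq_mul]
    push_cast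
    have : (‖C - -C‖ / 2) ^ 2 = C ^ 2 := by
      rw [Real.norm_eq_abs, div_pow, sq_abs]; ring
    rw [this]
    -- For `C = 0` both exponents are quotients by zero, hence `0`.
    by_cases hC0 : C = 0
    · simp [hC0]
    · field_simp
  have h1 := key f hfm hC h0
  have h2 := key (fun x => -f x) hfm.neg (by simpa using hC) (by simp [integral_neg, h0])
  have hsub : {ω | t ≤ |empMean (fun i => W i ω) f|} ⊆
      {ω | t ≤ empMean (fun i => W i ω) f} ∪ {ω | t ≤ empMean (fun i => W i ω) fun x => -f x} := by
    intro ω hω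
    rw [Set.mem_ofPred_eq] at hω
    rcases le_abs.1 hω with h | h
    · exact Or.inl h
    · refine Or.inr ?_
      simp only [Set.mem_ofPred_eq, empMean_eq, Finset.sum_neg_distrib] at h ⊢
      linarith
  calc _ ≤ _ := measureReal_mono hsub
    _ ≤ _ := measureReal_union_le _ _
    _ ≤ _ := by linarith

end Sampling

/-! ### The population -/

/-- The moment and boundedness properties of covariates, noise and regression function. -/
structure IsBoundedDesign {p : ℕ} (c σ : ℝ) (PX : Measure (Fin p → ℝ)) (Pε : Measure ℝ)
    (μ : (Fin p → ℝ) → ℝ) : Prop where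
  measurable : Measurable μ
  memLp_noise : MemLp id 2 Pε
  integral_noise : ∫ e, e ∂Pε = 0
  integral_noise_sq : ∫ e, e ^ 2 ∂Pε = σ ^ 2
  abs_regr_le : ∀ᵐ x ∂PX, |μ x| ≤ c
  abs_coord_le : ∀ j, ∀ᵐ x ∂PX, |x j| ≤ c
  integral_coord_mul : ∀ j k, ∫ x, x j * x k ∂PX = if j = k then 1 else 0

/-- The coefficients of the best linear approximation of `μ` under an orthonormal design. -/
noncomputable def bestCoef {p : ℕ} (μ : (Fin p → ℝ) → ℝ) (PX : Measure (Fin p → ℝ)) (j : Fin p) :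
    ℝ :=
  ∫ x, μ x * x j ∂PX

/-- The error of the best linear approximation. -/
noncomputable def approxErr {p : ℕ} (μ : (Fin p → ℝ) → ℝ) (PX : Measure (Fin p → ℝ))
    (x : Fin p → ℝ) : ℝ :=
  μ x - ∑ j, bestCoef μ PX j * x j

/-- The mean square error of the best linear approximation. -/
noncomputable def approxMSE {p : ℕ} (μ : (Fin p → ℝ) → ℝ) (PX : Measure (Fin p → ℝ)) : ℝ :=
  ∫ x, approxErr μ PX x ^ 2 ∂PX

theorem integral_add_sq {E : Type*} [MeasurableSpace E] {D : Measure E} {f g : E → ℝ}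
    (hf : MemLp f 2 D) (hg : MemLp g 2 D) :
    ∫ x, (f x + g x) ^ 2 ∂D = ∫ x, f x ^ 2 ∂D + 2 * ∫ x, f x * g x ∂D + ∫ x, g x ^ 2 ∂D := by
  have hfg : Integrable (fun x => f x * g x) D := hf.integrable_mul hg
  have h2 : Integrable (fun x => 2 * (f x * g x)) D := hfg.const_mul 2
  have h3 : Integrable (fun x => f x ^ 2 + 2 * (f x * g x)) D := hf.integrable_sq.add h2
  rw [← integral_const_mul, ← integral_add hf.integrable_sq h2, ← integral_add h3 hg.integrable_sq]
  exact integral_congr_ae (.of_forall fun x => by simp only []; ring)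

/-- Multiplication by a bounded function preserves square integrability. -/
theorem memLp_bdd_mul {E : Type*} [MeasurableSpace E] {D : Measure E} {φ f : E → ℝ} {C : ℝ}
    (hφm : Measurable φ) (hφ : ∀ᵐ x ∂D, |φ x| ≤ C) (hf : MemLp f 2 D) :
    MemLp (fun x => φ x * f x) 2 D := by
  refine hf.of_le_mul (hφm.aestronglyMeasurable.mul hf.aestronglyMeasurable) (c := C) ?_
  filter_upwards [hφ] with x hx
  rw [norm_mul]
  exact mul_le_mul_of_nonneg_right hx (norm_nonneg _)

theorem integral_bdd_mul_sq_le {E : Type*} [MeasurableSpace E] {D : Measure E} {φ f : E → ℝ}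
    {C : ℝ} (hφ : ∀ᵐ x ∂D, |φ x| ≤ C) (hf : MemLp f 2 D) :
    ∫ x, (φ x * f x) ^ 2 ∂D ≤ C ^ 2 * ∫ x, f x ^ 2 ∂D := by
  rw [← integral_const_mul]
  refine integral_mono_of_nonneg (.of_forall fun x => sq_nonneg _)
    (hf.integrable_sq.const_mul _) ?_
  filter_upwards [hφ] with x hx
  simp only [mul_pow]
  refine mul_le_mul_of_nonneg_right ?_ (sq_nonneg _)
  rw [← sq_abs]
  exact pow_le_pow_left₀ (abs_nonneg _) hx 2

section Population

set_option linter.unusedSectionVars false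

variable {p : ℕ} {c σ : ℝ} {PX : Measure (Fin p → ℝ)} [IsProbabilityMeasure PX]
  {Pε : Measure ℝ} [IsProbabilityMeasure Pε] {μ : (Fin p → ℝ) → ℝ}

namespace IsBoundedDesign

theorem bound_nonneg (h : IsBoundedDesign c σ PX Pε μ) : 0 ≤ c := by
  obtain ⟨x, hx⟩ := h.abs_regr_le.exists
  exact (abs_nonneg _).trans hx

theorem memLp_regr (h : IsBoundedDesign c σ PX Pε μ) : MemLp μ 2 PX :=
  MemLp.of_bound h.measurable.aestronglyMeasurable c h.abs_regr_le

theorem memLp_coord (h : IsBoundedDesign c σ PX Pε μ) (j : Fin p) :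
    MemLp (fun x : Fin p → ℝ => x j) 2 PX :=
  MemLp.of_bound (measurable_pi_apply j).aestronglyMeasurable c (h.abs_coord_le j)

theorem memLp_linear (h : IsBoundedDesign c σ PX Pε μ) (u : Fin p → ℝ) :
    MemLp (fun x : Fin p → ℝ => ∑ j, u j * x j) 2 PX :=
  memLp_finsetSum _ fun j _ => (h.memLp_coord j).const_mul (u j)

theorem measurable_approxErr (h : IsBoundedDesign c σ PX Pε μ) : Measurable (approxErr μ PX) := by
  have := h.measurable
  unfold approxErr
  fun_prop

theorem memLp_approxErr (h : IsBoundedDesign c σ PX Pε μ) : MemLp (approxErr μ PX) 2 PX :=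
  h.memLp_regr.sub (h.memLp_linear _)

theorem integral_mul_linear (h : IsBoundedDesign c σ PX Pε μ) {f : (Fin p → ℝ) → ℝ}
    (hf : MemLp f 2 PX) (u : Fin p → ℝ) :
    ∫ x, f x * ∑ j, u j * x j ∂PX = ∑ j, u j * ∫ x, f x * x j ∂PX := by
  have hi : ∀ j, Integrable (fun x : Fin p → ℝ => f x * x j) PX := fun j =>
    hf.integrable_mul (h.memLp_coord j)
  simp only [← integral_const_mul]
  rw [← integral_finsetSum _ fun j _ => (hi j).const_mul (u j)]
  refine integral_congr_ae (.of_forall fun x => ?_)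
  simp only [Finset.mul_sum]
  exact Finset.sum_congr rfl fun j _ => by ring

theorem integral_linear_mul_coord (h : IsBoundedDesign c σ PX Pε μ) (u : Fin p → ℝ) (k : Fin p) :
    ∫ x : Fin p → ℝ, (∑ j, u j * x j) * x k ∂PX = u k := by
  have := h.integral_mul_linear (h.memLp_coord k) u
  simp only [h.integral_coord_mul] at this
  simpa [mul_comm] using this

theorem integral_linear_sq (h : IsBoundedDesign c σ PX Pε μ) (u : Fin p → ℝ) :
    ∫ x : Fin p → ℝ, (∑ j, u j * x j) ^ 2 ∂PX = ∑ j, u j ^ 2 := by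
  have := h.integral_mul_linear (h.memLp_linear u) u
  simp only [h.integral_linear_mul_coord] at this
  simpa only [← pow_two] using this

theorem integral_approxErr_mul_coord (h : IsBoundedDesign c σ PX Pε μ) (k : Fin p) :
    ∫ x, approxErr μ PX x * x k ∂PX = 0 := by
  simp only [approxErr, sub_mul]
  have h1 : Integrable (fun x : Fin p → ℝ => μ x * x k) PX :=
    h.memLp_regr.integrable_mul (h.memLp_coord k)
  have h2 : Integrable (fun x : Fin p → ℝ => (∑ j, bestCoef μ PX j * x j) * x k) PX :=
    (h.memLp_linear _).integrable_mul (h.memLp_coord k)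
  rw [integral_sub h1 h2, h.integral_linear_mul_coord, bestCoef, sub_self]

theorem integral_approxErr_mul_linear (h : IsBoundedDesign c σ PX Pε μ) (u : Fin p → ℝ) :
    ∫ x, approxErr μ PX x * ∑ j, u j * x j ∂PX = 0 := by
  rw [h.integral_mul_linear h.memLp_approxErr]
  simp [h.integral_approxErr_mul_coord]

theorem approxMSE_nonneg : 0 ≤ approxMSE μ PX := integral_nonneg fun _ => sq_nonneg _

theorem approxMSE_add (h : IsBoundedDesign c σ PX Pε μ) :
    approxMSE μ PX + ∑ j, bestCoef μ PX j ^ 2 = ∫ x, μ x ^ 2 ∂PX := by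
  have := integral_add_sq h.memLp_approxErr (h.memLp_linear (bestCoef μ PX))
  rw [h.integral_linear_sq, h.integral_approxErr_mul_linear] at this
  simp only [approxErr, sub_add_cancel] at this
  rw [this, approxMSE]
  simp only [approxErr]
  ring

theorem integral_regr_sq_le (h : IsBoundedDesign c σ PX Pε μ) : ∫ x, μ x ^ 2 ∂PX ≤ c ^ 2 := by
  have : ∫ x, μ x ^ 2 ∂PX ≤ ∫ _, c ^ 2 ∂PX := by
    refine integral_mono_of_nonneg (.of_forall fun x => sq_nonneg _) (integrable_const _) ?_
    filter_upwards [h.abs_regr_le] with x hx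
    rw [← sq_abs]
    exact pow_le_pow_left₀ (abs_nonneg _) hx 2
  simpa using this

/-- Bessel's inequality. -/
theorem sum_bestCoef_sq_le (h : IsBoundedDesign c σ PX Pε μ) :
    ∑ j, bestCoef μ PX j ^ 2 ≤ c ^ 2 := by
  have h1 := h.approxMSE_add
  have h2 := h.integral_regr_sq_le
  have h3 : 0 ≤ approxMSE μ PX := approxMSE_nonneg
  linarith

theorem approxMSE_le (h : IsBoundedDesign c σ PX Pε μ) : approxMSE μ PX ≤ c ^ 2 := by
  have h1 := h.approxMSE_add
  have h2 := h.integral_regr_sq_le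
  have h3 : 0 ≤ ∑ j, bestCoef μ PX j ^ 2 := Finset.sum_nonneg fun _ _ => sq_nonneg _
  linarith

/-- Cauchy–Schwarz with Bessel's inequality for the coefficients: the sup norm of the approximation
error costs only a factor `√p`. -/
theorem approxErr_sq_le (h : IsBoundedDesign c σ PX Pε μ) :
    ∀ᵐ x ∂PX, approxErr μ PX x ^ 2 ≤ 2 * c ^ 2 + 2 * c ^ 4 * p := by
  filter_upwards [h.abs_regr_le, ae_all_iff.2 h.abs_coord_le] with x hx hxj
  have h1 : μ x ^ 2 ≤ c ^ 2 := by
    rw [← sq_abs]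
    exact pow_le_pow_left₀ (abs_nonneg _) hx 2
  have h2 : ∑ j, x j ^ 2 ≤ p * c ^ 2 := by
    have : ∑ j, x j ^ 2 ≤ ∑ _j : Fin p, c ^ 2 := Finset.sum_le_sum fun j _ => by
      rw [← sq_abs]
      exact pow_le_pow_left₀ (abs_nonneg _) (hxj j) 2
    simpa using this
  have h3 : (∑ j, bestCoef μ PX j * x j) ^ 2 ≤ c ^ 2 * (p * c ^ 2) :=
    (Finset.sum_mul_sq_le_sq_mul_sq _ _ _).trans
      (mul_le_mul h.sum_bestCoef_sq_le h2 (Finset.sum_nonneg fun _ _ => sq_nonneg _)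
        (sq_nonneg _))
  have h4 := sq_nonneg (μ x + ∑ j, bestCoef μ PX j * x j)
  rw [approxErr]
  nlinarith

/-! Square integrability and moments under the joint law. -/

theorem memLp_fst {f : (Fin p → ℝ) → ℝ} (hf : MemLp f 2 PX) :
    MemLp (fun w : (Fin p → ℝ) × ℝ => f w.1) 2 (PX.prod Pε) :=
  hf.comp_measurePreserving measurePreserving_fst

theorem memLp_snd (h : IsBoundedDesign c σ PX Pε μ) :
    MemLp (fun w : (Fin p → ℝ) × ℝ => w.2) 2 (PX.prod Pε) :=
  h.memLp_noise.comp_measurePreserving measurePreserving_snd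

theorem integral_fst (f : (Fin p → ℝ) → ℝ) :
    ∫ w, f w.1 ∂(PX.prod Pε) = ∫ x, f x ∂PX := by
  simpa using integral_prod_mul (μ := PX) (ν := Pε) f (fun _ => (1 : ℝ))

theorem ae_fst {q : (Fin p → ℝ) → Prop} (hq : ∀ᵐ x ∂PX, q x) :
    ∀ᵐ w ∂(PX.prod Pε), q w.1 :=
  (measurePreserving_fst (μ := PX) (ν := Pε)).quasiMeasurePreserving.ae hq

/-- The product formula needs no integrability, since integrals default to `0`; `f` may thus be
arbitrary. -/
theorem integral_fst_mul_noise (h : IsBoundedDesign c σ PX Pε μ) (f : (Fin p → ℝ) → ℝ) :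
    ∫ w, f w.1 * w.2 ∂(PX.prod Pε) = 0 := by
  rw [integral_prod_mul (μ := PX) (ν := Pε) f (fun e => e), h.integral_noise, mul_zero]

theorem integral_snd_sq (h : IsBoundedDesign c σ PX Pε μ) :
    ∫ w, w.2 ^ 2 ∂(PX.prod Pε) = σ ^ 2 := by
  have := integral_prod_mul (μ := PX) (ν := Pε) (fun _ => (1 : ℝ)) (fun e => e ^ 2)
  simpa [h.integral_noise_sq] using this

theorem integral_add_noise_sq (h : IsBoundedDesign c σ PX Pε μ) {f : (Fin p → ℝ) → ℝ}
    (hf : MemLp f 2 PX) :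
    ∫ w, (f w.1 + w.2) ^ 2 ∂(PX.prod Pε) = ∫ x, f x ^ 2 ∂PX + σ ^ 2 := by
  rw [integral_add_sq (memLp_fst hf) h.memLp_snd, h.integral_fst_mul_noise, h.integral_snd_sq,
    integral_fst fun x => f x ^ 2]
  ring

end IsBoundedDesign

end Population

/-! ### The quadratic loss of a linear model -/

/-- Extension by zero of a vector of coefficients from the model `α` to all covariates. -/
def zeroExt {p : ℕ} {α : Finset (Fin p)} (θ : α → ℝ) (j : Fin p) : ℝ :=
  if h : j ∈ α then θ ⟨j, h⟩ else 0

section Model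

variable {p : ℕ} {α : Finset (Fin p)}

theorem zeroExt_of_mem (θ : α → ℝ) {j : Fin p} (h : j ∈ α) : zeroExt θ j = θ ⟨j, h⟩ := dif_pos h

theorem zeroExt_of_notMem (θ : α → ℝ) {j : Fin p} (h : j ∉ α) : zeroExt θ j = 0 := dif_neg h

theorem zeroExt_coe (θ : α → ℝ) (j : α) : zeroExt θ j = θ j := dif_pos j.2

theorem sum_zeroExt_mul (θ : α → ℝ) (x : Fin p → ℝ) :
    ∑ j, zeroExt θ j * x j = ∑ j : α, θ j * x j := by
  rw [← Finset.sum_subset (Finset.subset_univ α)]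
  · rw [← Finset.sum_coe_sort]
    simp only [zeroExt_coe]
  · intro j _ hj
    rw [zeroExt_of_notMem _ hj, zero_mul]

theorem sum_zeroExt_sq (θ : α → ℝ) : ∑ j, zeroExt θ j ^ 2 = ∑ j : α, θ j ^ 2 := by
  simpa only [← pow_two, zeroExt_coe] using sum_zeroExt_mul θ (zeroExt θ)

theorem norm_sq_eq_sum_zeroExt (θ : EuclideanSpace ℝ α) :
    ‖θ‖ ^ 2 = ∑ j, zeroExt θ.ofLp j ^ 2 := by
  rw [EuclideanSpace.norm_sq_eq, sum_zeroExt_sq]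
  simp

/-- The residual of the model with coefficients `θ`, in terms of the best linear approximation. -/
theorem sqLoss_observe (σ : ℝ) (μ : (Fin p → ℝ) → ℝ) (PX : Measure (Fin p → ℝ))
    (w : (Fin p → ℝ) × ℝ) (θ : EuclideanSpace ℝ α) :
    sqLoss σ α (observe μ w) θ = (approxErr μ PX w.1 + w.2 +
      ∑ j, (bestCoef μ PX j - zeroExt θ.ofLp j) * w.1 j) ^ 2 - σ ^ 2 := by
  simp only [sqLoss, observe, approxErr, sub_mul, Finset.sum_sub_distrib, sum_zeroExt_mul]
  ring

/-- Pythagoras: noise, approximation error and linear functions of the covariates are mutually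
orthogonal, and the noise variance cancels `σ²`. -/
theorem predLoss_eq {c σ : ℝ} {PX : Measure (Fin p → ℝ)} [IsProbabilityMeasure PX]
    {Pε : Measure ℝ} [IsProbabilityMeasure Pε] {μ : (Fin p → ℝ) → ℝ}
    (h : IsBoundedDesign c σ PX Pε μ) (θ : EuclideanSpace ℝ α) :
    predLoss (obsLaw μ PX Pε) (sqLoss σ α) θ =
      approxMSE μ PX + ∑ j, (bestCoef μ PX j - zeroExt θ.ofLp j) ^ 2 := by
  have hm : Measurable (observe μ) := by
    have := h.measurable
    unfold observe
    fun_prop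
  have hs : Measurable fun z : Obs p => sqLoss σ α z θ := by
    unfold sqLoss
    fun_prop
  rw [predLoss, obsLaw, integral_map hm.aemeasurable hs.aestronglyMeasurable]
  obtain ⟨u, hu⟩ : ∃ u : Fin p → ℝ, ∀ j, bestCoef μ PX j - zeroExt θ.ofLp j = u j :=
    ⟨_, fun _ => rfl⟩
  simp only [sqLoss_observe σ μ PX, hu]
  have hf : MemLp (fun x => approxErr μ PX x + ∑ j, u j * x j) 2 PX :=
    h.memLp_approxErr.add (h.memLp_linear u)
  have hw : MemLp (fun w : (Fin p → ℝ) × ℝ => approxErr μ PX w.1 + ∑ j, u j * w.1 j + w.2) 2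
    (PX.prod Pε) := (IsBoundedDesign.memLp_fst hf).add h.memLp_snd
  have h1 := h.integral_add_noise_sq hf
  have h2 := integral_add_sq h.memLp_approxErr (h.memLp_linear u)
  rw [h.integral_approxErr_mul_linear, h.integral_linear_sq] at h2
  have h3 : ∀ w : (Fin p → ℝ) × ℝ, approxErr μ PX w.1 + w.2 + ∑ j, u j * w.1 j =
      approxErr μ PX w.1 + ∑ j, u j * w.1 j + w.2 := fun w => by ring
  simp only [h3]
  rw [integral_sub hw.integrable_sq (integrable_const _), h1, h2, approxMSE]
  simp

end Model

/-! ### Expansion of the empirical loss -/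

section Expansion

variable {p n : ℕ}

/-- The bilinear form with matrix `A`. -/
def bilin (A : Fin p → Fin p → ℝ) (a b : Fin p → ℝ) : ℝ := ∑ j, ∑ k, a j * b k * A j k

/-- Cauchy–Schwarz over index pairs. The Frobenius norm replaces the operator norm because its
second moment can be computed entry by entry. -/
theorem bilin_sq_le (A : Fin p → Fin p → ℝ) (a b : Fin p → ℝ) :
    bilin A a b ^ 2 ≤ (∑ j, a j ^ 2) * (∑ j, b j ^ 2) * ∑ j, ∑ k, A j k ^ 2 := by
  have h := Finset.sum_mul_sq_le_sq_mul_sq (Finset.univ : Finset (Fin p × Fin p))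
    (fun q => a q.1 * b q.2) (fun q => A q.1 q.2)
  simp only [Fintype.sum_prod_type, mul_pow] at h
  rwa [← Finset.sum_mul_sum] at h

theorem bilin_sub_sub (A : Fin p → Fin p → ℝ) (a b : Fin p → ℝ) :
    bilin A (fun j => a j - b j) (fun j => a j - b j) =
      bilin A a a - bilin A a b - bilin A b a + bilin A b b := by
  simp only [bilin, ← Finset.sum_sub_distrib, ← Finset.sum_add_distrib]
  exact Finset.sum_congr rfl fun j _ => Finset.sum_congr rfl fun k _ => by ring

/-- The error of the empirical Gram matrix. -/
noncomputable def gramErr (z : Fin n → (Fin p → ℝ) × ℝ) (j k : Fin p) : ℝ :=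
  empMean z fun w => w.1 j * w.1 k - if j = k then 1 else 0

/-- The empirical covariance of the covariates with `g x + e`. -/
noncomputable def crossErr (g : (Fin p → ℝ) → ℝ) (z : Fin n → (Fin p → ℝ) × ℝ) (j : Fin p) : ℝ :=
  empMean z fun w => w.1 j * (g w.1 + w.2)

theorem empMean_linear_sq (hn : n ≠ 0) (z : Fin n → (Fin p → ℝ) × ℝ) (u : Fin p → ℝ) :
    empMean z (fun w => (∑ j, u j * w.1 j) ^ 2) =
      ∑ j, u j ^ 2 + bilin (gramErr z) u u := by
  have h : ∀ w : (Fin p → ℝ) × ℝ, (∑ j, u j * w.1 j) ^ 2 =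
      ∑ j, u j ^ 2 + ∑ j, ∑ k, u j * u k * (w.1 j * w.1 k - if j = k then 1 else 0) := by
    intro w
    simp only [mul_sub, Finset.sum_sub_distrib, mul_ite, mul_one, mul_zero, Finset.sum_ite_eq,
      Finset.mem_univ, if_true, pow_two, Finset.sum_mul_sum]
    rw [add_sub_cancel]
    exact Finset.sum_congr rfl fun j _ => Finset.sum_congr rfl fun k _ => by ring
  simp only [h, empMean_add, empMean_const z hn, empMean_sum, empMean_const_mul, bilin, gramErr]

theorem empMean_add_linear_sq (hn : n ≠ 0) (g : (Fin p → ℝ) → ℝ) (z : Fin n → (Fin p → ℝ) × ℝ)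
    (u : Fin p → ℝ) :
    empMean z (fun w => (g w.1 + w.2 + ∑ j, u j * w.1 j) ^ 2) =
      empMean z (fun w => (g w.1 + w.2) ^ 2) + 2 * ∑ j, u j * crossErr g z j +
        (∑ j, u j ^ 2 + bilin (gramErr z) u u) := by
  have h : ∀ w : (Fin p → ℝ) × ℝ, (g w.1 + w.2 + ∑ j, u j * w.1 j) ^ 2 =
      (g w.1 + w.2) ^ 2 + 2 * ∑ j, u j * (w.1 j * (g w.1 + w.2)) + (∑ j, u j * w.1 j) ^ 2 := by
    intro w
    have : ∑ j, u j * (w.1 j * (g w.1 + w.2)) = (∑ j, u j * w.1 j) * (g w.1 + w.2) := by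
      rw [Finset.sum_mul]
      exact Finset.sum_congr rfl fun j _ => by ring
    rw [this]
    ring
  simp only [h, empMean_add, empMean_const_mul, empMean_sum, empMean_linear_sq hn, crossErr]

theorem abs_bilin_self_le {A : Fin p → Fin p → ℝ} {s : ℝ} (hs : 0 ≤ s)
    (hA : ∑ j, ∑ k, A j k ^ 2 ≤ s ^ 2) (u : Fin p → ℝ) :
    |bilin A u u| ≤ s * ∑ j, u j ^ 2 := by
  have hU : 0 ≤ ∑ j, u j ^ 2 := Finset.sum_nonneg fun _ _ => sq_nonneg _
  refine abs_le_of_sq_le_sq ?_ (by positivity)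
  refine (bilin_sq_le A u u).trans ?_
  have := mul_le_mul_of_nonneg_left hA (mul_nonneg hU hU)
  linarith [this]

/-- The deviation from the best coefficients of a coefficient vector that is at least as good in
sample as they are. Here `d` is the deviation and `v` is the part of the best coefficients that is
not in the model. -/
theorem sum_sq_le_of_empMean_le (hn : n ≠ 0) (g : (Fin p → ℝ) → ℝ)
    (z : Fin n → (Fin p → ℝ) × ℝ) (v d : Fin p → ℝ) (hvd : ∑ j, v j * d j = 0)
    (hle : empMean z (fun w => (g w.1 + w.2 + ∑ j, (v j - d j) * w.1 j) ^ 2) ≤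
      empMean z (fun w => (g w.1 + w.2 + ∑ j, v j * w.1 j) ^ 2))
    (hA : ∑ j, ∑ k, gramErr z j k ^ 2 ≤ 1 / 4) :
    ∑ j, d j ^ 2 ≤ 48 * ∑ j, crossErr g z j ^ 2 +
      24 * ((∑ j, v j ^ 2) * ∑ j, ∑ k, gramErr z j k ^ 2) := by
  rw [empMean_add_linear_sq hn g z fun j => v j - d j, empMean_add_linear_sq hn g z v,
    bilin_sub_sub] at hle
  have e1 : ∑ j, (v j - d j) ^ 2 = ∑ j, v j ^ 2 + ∑ j, d j ^ 2 := by
    have : ∑ j, (v j - d j) ^ 2 = ∑ j, v j ^ 2 - 2 * ∑ j, v j * d j + ∑ j, d j ^ 2 := by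
      rw [Finset.mul_sum, ← Finset.sum_sub_distrib, ← Finset.sum_add_distrib]
      exact Finset.sum_congr rfl fun j _ => by ring
    rw [this, hvd]
    ring
  simp only [e1, sub_mul, Finset.sum_sub_distrib] at hle
  have hdd := abs_le.1 (abs_bilin_self_le (s := 1 / 2) (by norm_num)
    (hA.trans (by norm_num)) d)
  have hr := Finset.sum_mul_sq_le_sq_mul_sq Finset.univ d (crossErr g z)
  have h1 := bilin_sq_le (gramErr z) v d
  have h2 := bilin_sq_le (gramErr z) d v
  have hD : 0 ≤ ∑ j, d j ^ 2 := Finset.sum_nonneg fun _ _ => sq_nonneg _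
  have hV : 0 ≤ ∑ j, v j ^ 2 := Finset.sum_nonneg fun _ _ => sq_nonneg _
  have hR : 0 ≤ ∑ j, crossErr g z j ^ 2 := Finset.sum_nonneg fun _ _ => sq_nonneg _
  have hT : 0 ≤ ∑ j, ∑ k, gramErr z j k ^ 2 :=
    Finset.sum_nonneg fun _ _ => Finset.sum_nonneg fun _ _ => sq_nonneg _
  generalize ∑ j, d j ^ 2 = D at *
  generalize ∑ j, v j ^ 2 = V at *
  generalize ∑ j, crossErr g z j ^ 2 = R at *
  generalize ∑ j, ∑ k, gramErr z j k ^ 2 = T at *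
  generalize ∑ j, d j * crossErr g z j = a at *
  generalize bilin (gramErr z) v d = b at *
  generalize bilin (gramErr z) d v = b' at *
  -- The basic inequality of least squares: after cancellation `D` plus the quadratic form at `d` is
  -- at most `2a + b + b'`, and the form is at least `-D/2`.
  have hlin : D / 2 ≤ 2 * a + b + b' := by linarith [hdd.1]
  -- From `(x + y + z)² ≤ 3 (x² + y² + z²)` with `a² ≤ D R` and `b², b'² ≤ D V T`; dividing by `D`
  -- gives the constants 48 and 24.
  have hsq : (D / 2) ^ 2 ≤ D * (12 * R + 6 * (V * T)) := by
    have : (D / 2) ^ 2 ≤ (2 * a + b + b') ^ 2 := pow_le_pow_left₀ (by positivity) hlin 2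
    nlinarith [sq_nonneg (2 * a - b), sq_nonneg (2 * a - b'), sq_nonneg (b - b')]
  rcases hD.eq_or_lt with h0 | h0
  · rw [← h0]
    positivity
  · have : D * (D / 4) ≤ D * (12 * R + 6 * (V * T)) := by linarith [hsq]
    linarith [le_of_mul_le_mul_left this h0]

end Expansion

/-! ### The penalty -/

section Penalty

variable {p n : ℕ} {α : Finset (Fin p)}

/-- The covariates of the model `α`. -/
def modelCov (α : Finset (Fin p)) (x : Fin p → ℝ) : EuclideanSpace ℝ α :=
  WithLp.toLp 2 fun j => x j

theorem sqLoss_eq_inner (σ : ℝ) (z : Obs p) (θ : EuclideanSpace ℝ α) :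
    sqLoss σ α z θ = (z.2 - inner ℝ (modelCov α z.1) θ) ^ 2 - σ ^ 2 := by
  simp [sqLoss, modelCov, PiLp.inner_apply]

theorem score_sqLoss (σ : ℝ) (z : Obs p) (θ : EuclideanSpace ℝ α) :
    score (sqLoss σ α) z θ =
      (-2 * (z.2 - inner ℝ (modelCov α z.1) θ)) • modelCov α z.1 := by
  have h1 : HasFDerivAt (fun θ : EuclideanSpace ℝ α => z.2 - inner ℝ (modelCov α z.1) θ)
      (-innerSL ℝ (modelCov α z.1)) θ :=
    ((innerSL ℝ (modelCov α z.1)).hasFDerivAt (x := θ)).const_sub z.2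
  have h2 := (h1.pow 2).sub_const (σ ^ 2)
  refine HasGradientAt.gradient ?_
  rw [hasGradientAt_iff_hasFDerivAt]
  have h3 : sqLoss σ α z = fun θ : EuclideanSpace ℝ α =>
      (z.2 - inner ℝ (modelCov α z.1) θ) ^ 2 - σ ^ 2 := funext fun θ => sqLoss_eq_inner σ z θ
  rw [h3]
  refine h2.congr_fderiv ?_
  ext v
  simp
  try ring

theorem hessian_sqLoss (σ : ℝ) (z : Obs p) (θ : EuclideanSpace ℝ α) (j k : α) :
    hessian (sqLoss σ α) z θ j k = 2 * (z.1 j * z.1 k) := by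
  have h0 : score (sqLoss σ α) z = fun θ =>
      (-2 * (z.2 - inner ℝ (modelCov α z.1) θ)) • modelCov α z.1 :=
    funext fun θ => score_sqLoss σ z θ
  have h1 : HasFDerivAt (fun θ : EuclideanSpace ℝ α => z.2 - inner ℝ (modelCov α z.1) θ)
      (-innerSL ℝ (modelCov α z.1)) θ :=
    ((innerSL ℝ (modelCov α z.1)).hasFDerivAt (x := θ)).const_sub z.2
  have h2 := (h1.const_mul (-2)).smul_const (modelCov α z.1)
  rw [hessian, Matrix.of_apply, h0, h2.fderiv]
  simp [modelCov, PiLp.inner_apply]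
  ring

/-- If `V ≥ 1` as a quadratic form, then `0 ≤ V⁻¹ ≤ 1`. -/
theorem dotProduct_inv_mulVec_le {ι : Type*} [Fintype ι] [DecidableEq ι] (V : Matrix ι ι ℝ)
    (hV : ∀ y : ι → ℝ, y ⬝ᵥ y ≤ y ⬝ᵥ V.mulVec y) (s : ι → ℝ) :
    0 ≤ s ⬝ᵥ (V⁻¹).mulVec s ∧ s ⬝ᵥ (V⁻¹).mulVec s ≤ s ⬝ᵥ s := by
  have hs : 0 ≤ s ⬝ᵥ s := Finset.sum_nonneg fun _ _ => mul_self_nonneg _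
  by_cases hu : IsUnit V.det
  · set y := (V⁻¹).mulVec s with hy
    have hVy : V.mulVec y = s := by
      rw [hy, Matrix.mulVec_mulVec, Matrix.mul_nonsing_inv _ hu, Matrix.one_mulVec]
    have h1 := hV y
    rw [hVy, dotProduct_comm y s] at h1
    have h0 : 0 ≤ y ⬝ᵥ y := Finset.sum_nonneg fun _ _ => mul_self_nonneg _
    have h2 : (s ⬝ᵥ y) ^ 2 ≤ (s ⬝ᵥ s) * (y ⬝ᵥ y) := by
      have := Finset.sum_mul_sq_le_sq_mul_sq Finset.univ s y
      simpa only [dotProduct, pow_two] using this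
    refine ⟨h0.trans h1, ?_⟩
    -- With `y = V⁻¹ s`, `(s·y)² ≤ (s·s)(y·y) ≤ (s·s)(s·y)`; cancel `s·y`.
    nlinarith
  · rw [Matrix.nonsing_inv_apply_not_isUnit _ hu]
    simpa using hs

/-- The trace against a rank-one matrix `s sᵀ` is the quadratic form of `V⁻¹` at `s`. -/
theorem trace_inv_mul_empMean {ι Z : Type*} [Fintype ι] [DecidableEq ι] (V : Matrix ι ι ℝ)
    (hV : ∀ y : ι → ℝ, y ⬝ᵥ y ≤ y ⬝ᵥ V.mulVec y) (z : Fin n → Z) (s : Z → ι → ℝ) :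
    0 ≤ (V⁻¹ * empMean z fun x => Matrix.vecMulVec (s x) (s x)).trace ∧
    (V⁻¹ * empMean z fun x => Matrix.vecMulVec (s x) (s x)).trace ≤
      empMean z fun x => s x ⬝ᵥ s x := by
  have h : (V⁻¹ * empMean z fun x => Matrix.vecMulVec (s x) (s x)).trace =
      empMean z fun x => s x ⬝ᵥ (V⁻¹).mulVec (s x) := by
    rw [empMean, Matrix.mul_smul, Matrix.trace_smul, Matrix.mul_sum, Matrix.trace_sum, empMean]
    simp only [Matrix.mul_vecMulVec, Matrix.trace_vecMulVec, dotProduct_comm]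
  rw [h]
  exact ⟨empMean_nonneg z fun i => (dotProduct_inv_mulVec_le V hV _).1,
    empMean_mono z fun i => (dotProduct_inv_mulVec_le V hV _).2⟩

theorem dotProduct_Vhat_mulVec (hn : n ≠ 0) (σ : ℝ) (μ : (Fin p → ℝ) → ℝ)
    (z : Fin n → (Fin p → ℝ) × ℝ) (θ : EuclideanSpace ℝ α) (y : α → ℝ) :
    y ⬝ᵥ (Vhat (sqLoss σ α) (fun i => observe μ (z i)) θ).mulVec y =
      2 * (∑ j, zeroExt y j ^ 2 + bilin (gramErr z) (zeroExt y) (zeroExt y)) := by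
  have hH : ∀ w, hessian (sqLoss σ α) (observe μ w) θ =
      (2 : ℝ) • Matrix.vecMulVec (fun j : α => w.1 j) (fun j : α => w.1 j) := fun w => by
    ext j k
    simp [hessian_sqLoss, Matrix.vecMulVec_apply, observe]
  have hq : ∀ x : α → ℝ, y ⬝ᵥ (Matrix.vecMulVec x x).mulVec y = (∑ j, y j * x j) ^ 2 := fun x => by
    rw [Matrix.vecMulVec_mulVec, op_smul_eq_smul, dotProduct_smul, smul_eq_mul,
      dotProduct_comm x y, pow_two]
    rfl
  rw [← empMean_linear_sq hn]
  simp only [sum_zeroExt_mul, Vhat, empMean, hH, Matrix.smul_mulVec, Matrix.sum_mulVec,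
    dotProduct_smul, dotProduct_sum, hq, smul_eq_mul, ← Finset.mul_sum]
  ring

/-- The penalty is at most the size of the model times the mean square residual, up to constants. -/
theorem penalty_bounds (hn : n ≠ 0) (σ c : ℝ) (μ : (Fin p → ℝ) → ℝ)
    (z : Fin n → (Fin p → ℝ) × ℝ) (hz : ∀ i j, |(z i).1 j| ≤ c) (θ : EuclideanSpace ℝ α)
    (hA : ∑ j, ∑ k, gramErr z j k ^ 2 ≤ 1 / 4) :
    0 ≤ ((Vhat (sqLoss σ α) (fun i => observe μ (z i)) θ)⁻¹ *
      Jhat (sqLoss σ α) (fun i => observe μ (z i)) θ).trace ∧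
    ((Vhat (sqLoss σ α) (fun i => observe μ (z i)) θ)⁻¹ *
      Jhat (sqLoss σ α) (fun i => observe μ (z i)) θ).trace ≤
      4 * c ^ 2 * p * (empMean (fun i => observe μ (z i)) (fun x => sqLoss σ α x θ) + σ ^ 2) := by
  set V := Vhat (sqLoss σ α) (fun i => observe μ (z i)) θ with hVdef
  have hV : ∀ y : α → ℝ, y ⬝ᵥ y ≤ y ⬝ᵥ V.mulVec y := by
    intro y
    rw [hVdef, dotProduct_Vhat_mulVec hn]
    -- The factor 2 in the Hessian of a square makes up for the loss of at most one half to the Gram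
    -- error.
    have h1 := abs_le.1 (abs_bilin_self_le (s := 1 / 2) (by norm_num)
      (hA.trans (by norm_num)) (zeroExt y))
    have h2 : y ⬝ᵥ y = ∑ j, zeroExt y j ^ 2 := by
      rw [sum_zeroExt_sq]
      simp only [dotProduct, pow_two]
    linarith [h1.1]
  have h := trace_inv_mul_empMean V hV (fun i => observe μ (z i))
    (fun x j => score (sqLoss σ α) x θ j)
  refine ⟨h.1, h.2.trans ?_⟩
  rw [← empMean_const (fun i => observe μ (z i)) hn (σ ^ 2), ← empMean_add, ← empMean_const_mul]
  refine empMean_mono _ fun i => ?_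
  have hx : ∑ j : α, (z i).1 j ^ 2 ≤ c ^ 2 * p := by
    have : ∑ j : α, (z i).1 j ^ 2 ≤ ∑ _j : α, c ^ 2 := Finset.sum_le_sum fun j _ => by
      rw [← sq_abs]
      exact pow_le_pow_left₀ (abs_nonneg _) (hz i j) 2
    refine this.trans ?_
    have hc : (α.card : ℝ) ≤ p := by
      exact_mod_cast (Finset.card_le_univ α).trans_eq (Fintype.card_fin p)
    simp only [Finset.sum_const, Finset.card_univ, Fintype.card_coe, nsmul_eq_mul]
    nlinarith [sq_nonneg c]
  simp only [score_sqLoss, sqLoss_eq_inner, sub_add_cancel, dotProduct, PiLp.smul_apply,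
    smul_eq_mul]
  set a := (observe μ (z i)).2 - inner ℝ (modelCov α (observe μ (z i)).1) θ
  have : ∑ j : α, -2 * a * (modelCov α (observe μ (z i)).1) j *
      (-2 * a * (modelCov α (observe μ (z i)).1) j) = 4 * a ^ 2 * ∑ j : α, (z i).1 j ^ 2 := by
    rw [Finset.mul_sum]
    refine Finset.sum_congr rfl fun j _ => ?_
    simp only [modelCov, observe]
    ring
  rw [this]
  have := mul_le_mul_of_nonneg_left hx (by positivity : 0 ≤ 4 * a ^ 2)
  linarith

end Penalty

/-! ### Moments of the empirical errors -/

/-- The centred empirical mean of `g² + 2 g e`, where `g` is the approximation error. -/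
noncomputable def baseErr {p n : ℕ} (μ : (Fin p → ℝ) → ℝ) (PX : Measure (Fin p → ℝ))
    (z : Fin n → (Fin p → ℝ) × ℝ) : ℝ :=
  empMean z fun w => approxErr μ PX w.1 * approxErr μ PX w.1 + 2 * (approxErr μ PX w.1 * w.2) -
    approxMSE μ PX

/-- Subtracting the mean does not increase the second moment. -/
theorem integral_sub_mean_sq_le {E : Type*} [MeasurableSpace E] {D : Measure E}
    [IsProbabilityMeasure D] {f : E → ℝ} (hf : MemLp f 2 D) {m : ℝ} (hm : ∫ x, f x ∂D = m) :
    ∫ x, (f x - m) ^ 2 ∂D ≤ ∫ x, f x ^ 2 ∂D := by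
  have h := integral_add_sq hf (memLp_const (-m) : MemLp (fun _ => -m) 2 D)
  simp only [← sub_eq_add_neg, integral_mul_const, hm, integral_const, probReal_univ,
    smul_eq_mul] at h
  rw [h]
  nlinarith [sq_nonneg m]

section Moments

set_option linter.unusedSectionVars false

variable {Ω : Type*} [MeasurableSpace Ω] {P : Measure Ω} [IsProbabilityMeasure P]
  {p n : ℕ} {c σ : ℝ} {PX : Measure (Fin p → ℝ)} [IsProbabilityMeasure PX]
  {Pε : Measure ℝ} [IsProbabilityMeasure Pε] {μ : (Fin p → ℝ) → ℝ}
  {W : Fin n → Ω → (Fin p → ℝ) × ℝ}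

namespace IsBoundedDesign

theorem abs_gram_le (h : IsBoundedDesign c σ PX Pε μ) (j k : Fin p) :
    ∀ᵐ w ∂(PX.prod Pε), |w.1 j * w.1 k - if j = k then 1 else 0| ≤ c ^ 2 + 1 := by
  filter_upwards [ae_fst (Pε := Pε) (h.abs_coord_le j), ae_fst (Pε := Pε) (h.abs_coord_le k)]
    with w hj hk
  refine (abs_sub _ _).trans (add_le_add ?_ ?_)
  · rw [abs_mul, pow_two]
    exact mul_le_mul hj hk (abs_nonneg _) h.bound_nonneg
  · split_ifs <;> simp

theorem measurable_gram (j k : Fin p) :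
    Measurable fun w : (Fin p → ℝ) × ℝ => w.1 j * w.1 k - if j = k then (1 : ℝ) else 0 := by
  fun_prop

theorem memLp_gram (h : IsBoundedDesign c σ PX Pε μ) (j k : Fin p) :
    MemLp (fun w : (Fin p → ℝ) × ℝ => w.1 j * w.1 k - if j = k then (1 : ℝ) else 0) 2
      (PX.prod Pε) :=
  MemLp.of_bound (measurable_gram j k).aestronglyMeasurable _ (h.abs_gram_le j k)

theorem integral_gram (h : IsBoundedDesign c σ PX Pε μ) (j k : Fin p) :
    ∫ w, (w.1 j * w.1 k - if j = k then (1 : ℝ) else 0) ∂(PX.prod Pε) = 0 := by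
  rw [integral_fst fun x => x j * x k - if j = k then (1 : ℝ) else 0, integral_sub,
    h.integral_coord_mul]
  · simp
  · exact (h.memLp_coord j).integrable_mul (h.memLp_coord k)
  · exact integrable_const _

theorem integrable_gramErr_sq (h : IsBoundedDesign c σ PX Pε μ)
    (hW : ∀ i, HasLaw (W i) (PX.prod Pε) P) :
    Integrable (fun ω => ∑ j, ∑ k, gramErr (fun i => W i ω) j k ^ 2) P :=
  integrable_finsetSum _ fun j _ => integrable_finsetSum _ fun k _ =>
    (memLp_empMean hW (h.memLp_gram j k)).integrable_sq

theorem integral_gramErr_sq_le (h : IsBoundedDesign c σ PX Pε μ) (hn : n ≠ 0)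
    (hW : ∀ i, HasLaw (W i) (PX.prod Pε) P) (hind : iIndepFun W P) :
    ∫ ω, ∑ j, ∑ k, gramErr (fun i => W i ω) j k ^ 2 ∂P ≤
      (c ^ 2 + 1) ^ 2 * ((p : ℝ) ^ 2 / n) := by
  have hi : ∀ j k, Integrable (fun ω => gramErr (fun i => W i ω) j k ^ 2) P := fun j k =>
    (memLp_empMean hW (h.memLp_gram j k)).integrable_sq
  rw [integral_finsetSum _ fun j _ => integrable_finsetSum _ fun k _ => hi j k]
  simp only [integral_finsetSum _ fun k _ => hi _ k]
  have hb : ∀ j k, ∫ ω, gramErr (fun i => W i ω) j k ^ 2 ∂P ≤ (n : ℝ)⁻¹ * (c ^ 2 + 1) ^ 2 := by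
    intro j k
    have := integral_empMean_sq hn hW hind (measurable_gram j k) (h.memLp_gram j k)
      (h.integral_gram j k)
    simp only [gramErr]
    rw [this]
    have h1 := integral_bdd_mul_sq_le (h.abs_gram_le j k) (memLp_const (1 : ℝ))
    simp only [mul_one, one_pow, integral_const, probReal_univ, smul_eq_mul] at h1
    gcongr
  calc _ ≤ ∑ _j : Fin p, ∑ _k : Fin p, (n : ℝ)⁻¹ * (c ^ 2 + 1) ^ 2 :=
        Finset.sum_le_sum fun j _ => Finset.sum_le_sum fun k _ => hb j k
    _ = _ := by
        simp only [Finset.sum_const, Finset.card_univ, Fintype.card_fin, nsmul_eq_mul]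
        ring

/-- Controls the event on which the loss is bounded only by a multiple of `p`, through the size of
the parameter space. Chebyshev's `p²/n` would contribute `p³/n` to the risk, which need not be
`o(n^(-ζ))`; Hoeffding with a union bound over the entries gives `p⁷/n²`. -/
theorem measureReal_gramErr_gt_le (h : IsBoundedDesign c σ PX Pε μ) (hn : n ≠ 0) (hp : p ≠ 0)
    (hW : ∀ i, HasLaw (W i) (PX.prod Pε) P) (hind : iIndepFun W P) :
    P.real {ω | 1 / 4 < ∑ j, ∑ k, gramErr (fun i => W i ω) j k ^ 2} ≤
      256 * (c ^ 2 + 1) ^ 4 * ((p : ℝ) ^ 6 / (n : ℝ) ^ 2) := by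
  have hp' : (0 : ℝ) < p := by positivity
  have hn' : (0 : ℝ) < n := by positivity
  set C := c ^ 2 + 1 with hC
  have hC0 : 0 < C := by positivity
  -- Then `p²` entries of square at most `t²` sum to at most `1/4`.
  set t : ℝ := (2 * p)⁻¹ with ht
  have hsub : {ω | 1 / 4 < ∑ j, ∑ k, gramErr (fun i => W i ω) j k ^ 2} ⊆
      ⋃ q ∈ (Finset.univ : Finset (Fin p × Fin p)),
        {ω | t ≤ |gramErr (fun i => W i ω) q.1 q.2|} := by
    intro ω hω
    by_contra hcon
    simp only [Finset.mem_univ, Set.iUnion_true, Set.mem_iUnion, Set.mem_ofPred_eq, Prod.exists,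
      not_exists, not_le] at hcon
    rw [Set.mem_ofPred_eq] at hω
    refine absurd hω (not_lt.2 ?_)
    have hjk : ∀ j k, gramErr (fun i => W i ω) j k ^ 2 ≤ t ^ 2 := fun j k => by
      rw [← sq_abs]
      exact pow_le_pow_left₀ (abs_nonneg _) (hcon j k).le 2
    calc _ ≤ ∑ _j : Fin p, ∑ _k : Fin p, t ^ 2 :=
          Finset.sum_le_sum fun j _ => Finset.sum_le_sum fun k _ => hjk j k
      _ = 1 / 4 := by
          simp only [Finset.sum_const, Finset.card_univ, Fintype.card_fin, nsmul_eq_mul, ht]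
          field_simp
          norm_num
  set x : ℝ := n * t ^ 2 / (2 * C ^ 2) with hx
  have hx0 : 0 < x := by positivity
  -- Second-order polynomial decay is enough, so the exponential is traded for it.
  have hexp : Real.exp (-x) ≤ 2 / x ^ 2 := by
    have := Real.quadratic_le_exp_of_nonneg hx0.le
    rw [Real.exp_neg, inv_eq_one_div, div_le_div_iff₀ (Real.exp_pos x) (by positivity)]
    nlinarith
  calc _ ≤ _ := measureReal_mono hsub (measure_ne_top _ _)
    _ ≤ _ := measureReal_biUnion_finset_le _ _
    _ ≤ ∑ _q : Fin p × Fin p, 2 * Real.exp (-x) := by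
        refine Finset.sum_le_sum fun q _ => ?_
        have := measureReal_abs_empMean_ge_le hn hW hind (measurable_gram q.1 q.2)
          (h.abs_gram_le q.1 q.2) (h.integral_gram q.1 q.2) (t := t) (by positivity)
        rw [neg_div] at this
        exact this
    _ ≤ ∑ _q : Fin p × Fin p, 2 * (2 / x ^ 2) := by gcongr
    _ = _ := by
        simp only [Finset.sum_const, Finset.card_univ, Fintype.card_prod, Fintype.card_fin,
          nsmul_eq_mul, hx, ht]
        push_cast
        field_simp
        norm_num

theorem memLp_cross (h : IsBoundedDesign c σ PX Pε μ) (j : Fin p) :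
    MemLp (fun w : (Fin p → ℝ) × ℝ => w.1 j * (approxErr μ PX w.1 + w.2)) 2 (PX.prod Pε) :=
  memLp_bdd_mul (by fun_prop) (ae_fst (h.abs_coord_le j))
    ((memLp_fst h.memLp_approxErr).add h.memLp_snd)

theorem integrable_crossErr_sq (h : IsBoundedDesign c σ PX Pε μ)
    (hW : ∀ i, HasLaw (W i) (PX.prod Pε) P) :
    Integrable (fun ω => ∑ j, crossErr (approxErr μ PX) (fun i => W i ω) j ^ 2) P :=
  integrable_finsetSum _ fun j _ => (memLp_empMean hW (h.memLp_cross j)).integrable_sq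

theorem integral_crossErr_sq_le (h : IsBoundedDesign c σ PX Pε μ) (hn : n ≠ 0)
    (hW : ∀ i, HasLaw (W i) (PX.prod Pε) P) (hind : iIndepFun W P) :
    ∫ ω, ∑ j, crossErr (approxErr μ PX) (fun i => W i ω) j ^ 2 ∂P ≤
      c ^ 2 * (c ^ 2 + σ ^ 2) * ((p : ℝ) / n) := by
  have hi : ∀ j, Integrable (fun ω => crossErr (approxErr μ PX) (fun i => W i ω) j ^ 2) P :=
    fun j => (memLp_empMean hW (h.memLp_cross j)).integrable_sq
  rw [integral_finsetSum _ fun j _ => hi j]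
  have hb : ∀ j, ∫ ω, crossErr (approxErr μ PX) (fun i => W i ω) j ^ 2 ∂P ≤
      (n : ℝ)⁻¹ * (c ^ 2 * (c ^ 2 + σ ^ 2)) := by
    intro j
    have hm : Measurable fun w : (Fin p → ℝ) × ℝ => w.1 j * (approxErr μ PX w.1 + w.2) := by
      have := h.measurable_approxErr
      fun_prop
    -- The normal equations remove the approximation error, independence the noise.
    have h0 : ∫ w, w.1 j * (approxErr μ PX w.1 + w.2) ∂(PX.prod Pε) = 0 := by
      have i1 : Integrable (fun w : (Fin p → ℝ) × ℝ => w.1 j * approxErr μ PX w.1)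
          (PX.prod Pε) := (memLp_fst (h.memLp_coord j)).integrable_mul (memLp_fst h.memLp_approxErr)
      have i2 : Integrable (fun w : (Fin p → ℝ) × ℝ => w.1 j * w.2) (PX.prod Pε) :=
        (memLp_fst (h.memLp_coord j)).integrable_mul h.memLp_snd
      simp only [mul_add]
      rw [integral_add i1 i2, integral_fst fun x => x j * approxErr μ PX x, h.integral_fst_mul_noise fun x => x j]
      simp only [mul_comm (_ : ℝ) (approxErr μ PX _), h.integral_approxErr_mul_coord, add_zero]
    simp only [crossErr]
    rw [integral_empMean_sq hn hW hind hm (h.memLp_cross j) h0]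
    have h1 := integral_bdd_mul_sq_le (ae_fst (Pε := Pε) (h.abs_coord_le j))
      ((memLp_fst h.memLp_approxErr).add h.memLp_snd)
    simp only [Pi.add_apply] at h1
    rw [h.integral_add_noise_sq h.memLp_approxErr] at h1
    have h2 := h.approxMSE_le
    rw [approxMSE] at h2
    gcongr
    refine h1.trans ?_
    gcongr
  calc _ ≤ ∑ _j : Fin p, (n : ℝ)⁻¹ * (c ^ 2 * (c ^ 2 + σ ^ 2)) :=
        Finset.sum_le_sum fun j _ => hb j
    _ = _ := by
        simp only [Finset.sum_const, Finset.card_univ, Fintype.card_fin, nsmul_eq_mul]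
        ring

theorem abs_approxErr_le_sqrt (h : IsBoundedDesign c σ PX Pε μ) :
    ∀ᵐ w ∂(PX.prod Pε), |approxErr μ PX w.1| ≤ √(2 * c ^ 2 + 2 * c ^ 4 * p) :=
  ae_fst (h.approxErr_sq_le.mono fun _ hx => Real.abs_le_sqrt hx)

theorem memLp_base (h : IsBoundedDesign c σ PX Pε μ) :
    MemLp (fun w : (Fin p → ℝ) × ℝ =>
      approxErr μ PX w.1 * approxErr μ PX w.1 + 2 * (approxErr μ PX w.1 * w.2)) 2
      (PX.prod Pε) := by
  have hg : Measurable fun w : (Fin p → ℝ) × ℝ => approxErr μ PX w.1 :=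
    h.measurable_approxErr.comp measurable_fst
  exact (memLp_bdd_mul hg h.abs_approxErr_le_sqrt (memLp_fst h.memLp_approxErr)).add
    ((memLp_bdd_mul hg h.abs_approxErr_le_sqrt h.memLp_snd).const_mul 2)

theorem integrable_baseErr_sq (h : IsBoundedDesign c σ PX Pε μ)
    (hW : ∀ i, HasLaw (W i) (PX.prod Pε) P) :
    Integrable (fun ω => baseErr μ PX (fun i => W i ω) ^ 2) P :=
  (memLp_empMean hW (h.memLp_base.sub (memLp_const (approxMSE μ PX)))).integrable_sq

/-- The factor `approxMSE` is essential: it makes the fluctuation small relative to the loss. A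
constant in its place would lead to a probability of order `1/(n b²)`, which need not vanish when `ζ
≥ 1/2`. -/
theorem integral_baseErr_sq_le (h : IsBoundedDesign c σ PX Pε μ) (hn : n ≠ 0)
    (hW : ∀ i, HasLaw (W i) (PX.prod Pε) P) (hind : iIndepFun W P) :
    ∫ ω, baseErr μ PX (fun i => W i ω) ^ 2 ∂P ≤
      (2 * c ^ 2 + 2 * c ^ 4 * p + 4 * σ ^ 2) * approxMSE μ PX / n := by
  have hg := h.measurable_approxErr
  have hgg : MemLp (fun w : (Fin p → ℝ) × ℝ => approxErr μ PX w.1 * approxErr μ PX w.1) 2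
      (PX.prod Pε) :=
    memLp_bdd_mul (hg.comp measurable_fst) h.abs_approxErr_le_sqrt (memLp_fst h.memLp_approxErr)
  have hge : MemLp (fun w : (Fin p → ℝ) × ℝ => 2 * (approxErr μ PX w.1 * w.2)) 2
      (PX.prod Pε) :=
    (memLp_bdd_mul (hg.comp measurable_fst) h.abs_approxErr_le_sqrt h.memLp_snd).const_mul 2
  have hmean : ∫ w, (approxErr μ PX w.1 * approxErr μ PX w.1 + 2 * (approxErr μ PX w.1 * w.2))
      ∂(PX.prod Pε) = approxMSE μ PX := by
    rw [integral_add (hgg.integrable one_le_two) (hge.integrable one_le_two), integral_const_mul,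
      h.integral_fst_mul_noise, integral_fst fun x => approxErr μ PX x * approxErr μ PX x,
      approxMSE]
    simp only [pow_two, mul_zero, add_zero]
  have hsq : ∫ w, (approxErr μ PX w.1 * approxErr μ PX w.1 + 2 * (approxErr μ PX w.1 * w.2)) ^ 2
      ∂(PX.prod Pε) ≤ (2 * c ^ 2 + 2 * c ^ 4 * p + 4 * σ ^ 2) * approxMSE μ PX := by
    rw [integral_add_sq hgg hge]
    have e1 := integral_bdd_mul_sq_le h.abs_approxErr_le_sqrt
      (memLp_fst (Pε := Pε) h.memLp_approxErr)
    rw [Real.sq_sqrt (by positivity), integral_fst fun x => approxErr μ PX x ^ 2] at e1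
    have e2 : ∫ w, approxErr μ PX w.1 * approxErr μ PX w.1 * (2 * (approxErr μ PX w.1 * w.2))
        ∂(PX.prod Pε) = 0 := by
      rw [← h.integral_fst_mul_noise fun x =>
        approxErr μ PX x * approxErr μ PX x * (2 * approxErr μ PX x)]
      exact integral_congr_ae (.of_forall fun w => by ring)
    have e3 : ∫ w, (2 * (approxErr μ PX w.1 * w.2)) ^ 2 ∂(PX.prod Pε) =
        4 * (approxMSE μ PX * σ ^ 2) := by
      simp only [mul_pow]
      rw [integral_const_mul, integral_prod_mul (μ := PX) (ν := Pε)
        (fun x => approxErr μ PX x ^ 2) (fun e => e ^ 2), h.integral_noise_sq, approxMSE]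
      norm_num
    rw [e2, e3]
    rw [← approxMSE] at e1
    linarith
  have hm : Measurable fun w : (Fin p → ℝ) × ℝ =>
      approxErr μ PX w.1 * approxErr μ PX w.1 + 2 * (approxErr μ PX w.1 * w.2) -
        approxMSE μ PX := by
    fun_prop
  simp only [baseErr]
  rw [integral_empMean_sq hn hW hind hm (h.memLp_base.sub (memLp_const (approxMSE μ PX))),
    inv_mul_eq_div]
  · gcongr
    exact (integral_sub_mean_sq_le h.memLp_base hmean).trans hsq
  · rw [integral_sub (h.memLp_base.integrable one_le_two) (integrable_const _), hmean]
    simp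

theorem integrable_empMean_response_sq (h : IsBoundedDesign c σ PX Pε μ)
    (hW : ∀ i, HasLaw (W i) (PX.prod Pε) P) :
    Integrable (fun ω => empMean (fun i => W i ω) fun w => (μ w.1 + w.2) ^ 2) P :=
  integrable_empMean hW ((memLp_fst h.memLp_regr).add h.memLp_snd).integrable_sq

theorem integral_empMean_response_sq_le (h : IsBoundedDesign c σ PX Pε μ) (hn : n ≠ 0)
    (hW : ∀ i, HasLaw (W i) (PX.prod Pε) P) :
    ∫ ω, (empMean (fun i => W i ω) fun w => (μ w.1 + w.2) ^ 2) ∂P ≤ c ^ 2 + σ ^ 2 := by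
  rw [integral_empMean hn hW (f := fun w => (μ w.1 + w.2) ^ 2)
    ((memLp_fst h.memLp_regr).add h.memLp_snd).integrable_sq,
    h.integral_add_noise_sq h.memLp_regr]
  linarith [h.integral_regr_sq_le]

end IsBoundedDesign

end Moments

/-! ### The prediction loss of the minimum loss estimator -/

/-- The prediction loss of the best coefficients of the model `α`. -/
noncomputable def modelMSE {p : ℕ} (μ : (Fin p → ℝ) → ℝ) (PX : Measure (Fin p → ℝ))
    (α : Finset (Fin p)) : ℝ :=
  approxMSE μ PX + ∑ j, (bestCoef μ PX j - zeroExt (fun k : α => bestCoef μ PX k) j) ^ 2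

section Model

set_option linter.unusedSectionVars false

variable {p n : ℕ} {c σ : ℝ} {PX : Measure (Fin p → ℝ)} [IsProbabilityMeasure PX]
  {Pε : Measure ℝ} [IsProbabilityMeasure Pε] {μ : (Fin p → ℝ) → ℝ} {α : Finset (Fin p)}

/-- The deviation of `θ` from the best coefficients of the model. -/
noncomputable def coefDev (μ : (Fin p → ℝ) → ℝ) (PX : Measure (Fin p → ℝ))
    (θ : EuclideanSpace ℝ α) : EuclideanSpace ℝ α :=
  θ - WithLp.toLp 2 fun k : α => bestCoef μ PX k

theorem coef_sub_zeroExt (θ : EuclideanSpace ℝ α) (j : Fin p) :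
    bestCoef μ PX j - zeroExt θ.ofLp j =
      (bestCoef μ PX j - zeroExt (fun k : α => bestCoef μ PX k) j) -
        zeroExt (coefDev μ PX θ).ofLp j := by
  by_cases hj : j ∈ α
  · simp [zeroExt_of_mem _ hj, coefDev]
  · simp [zeroExt_of_notMem _ hj]

theorem sum_coef_mul_coefDev (θ : EuclideanSpace ℝ α) :
    ∑ j, (bestCoef μ PX j - zeroExt (fun k : α => bestCoef μ PX k) j) *
      zeroExt (coefDev μ PX θ).ofLp j = 0 := by
  refine Finset.sum_eq_zero fun j _ => ?_
  by_cases hj : j ∈ α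
  · simp [zeroExt_of_mem _ hj]
  · simp [zeroExt_of_notMem _ hj]

theorem predLoss_eq_modelMSE_add (h : IsBoundedDesign c σ PX Pε μ) (θ : EuclideanSpace ℝ α) :
    predLoss (obsLaw μ PX Pε) (sqLoss σ α) θ =
      modelMSE μ PX α + ∑ j, zeroExt (coefDev μ PX θ).ofLp j ^ 2 := by
  rw [predLoss_eq h, modelMSE, add_assoc]
  congr 1
  have h0 := sum_coef_mul_coefDev (μ := μ) (PX := PX) θ
  simp only [coef_sub_zeroExt θ, sub_sq (_ - _), Finset.sum_add_distrib, Finset.sum_sub_distrib]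
  simp only [mul_assoc, ← Finset.mul_sum, h0]
  ring

theorem modelMSE_le_predLoss (h : IsBoundedDesign c σ PX Pε μ) (θ : EuclideanSpace ℝ α) :
    modelMSE μ PX α ≤ predLoss (obsLaw μ PX Pε) (sqLoss σ α) θ := by
  rw [predLoss_eq_modelMSE_add h]
  exact le_add_of_nonneg_right (Finset.sum_nonneg fun _ _ => sq_nonneg _)

theorem approxMSE_le_modelMSE : approxMSE μ PX ≤ modelMSE μ PX α :=
  le_add_of_nonneg_right (Finset.sum_nonneg fun _ _ => sq_nonneg _)

/-- By Bessel the best coefficients lie in every parameter space, so the estimator can be compared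
with them. -/
theorem norm_bestCoef_le (h : IsBoundedDesign c σ PX Pε μ) :
    ‖(WithLp.toLp 2 fun k : α => bestCoef μ PX k : EuclideanSpace ℝ α)‖ ≤ c := by
  refine abs_le_of_sq_le_sq' ?_ h.bound_nonneg |>.2
  rw [EuclideanSpace.norm_sq_eq]
  refine le_trans ?_ h.sum_bestCoef_sq_le
  simp only [Real.norm_eq_abs, sq_abs]
  rw [Finset.sum_coe_sort α fun j => bestCoef μ PX j ^ 2]
  exact Finset.sum_le_sum_of_subset_of_nonneg (Finset.subset_univ α) fun _ _ _ => sq_nonneg _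

variable {H : Set (EuclideanSpace ℝ α)} {θ : EuclideanSpace ℝ α}

theorem sum_coefDev_sq_le_of_bounded (h : IsBoundedDesign c σ PX Pε μ) (hp : p ≠ 0) {K : ℝ}
    (hθ : ‖θ‖ ≤ K * √(p : ℝ)) :
    ∑ j, zeroExt (coefDev μ PX θ).ofLp j ^ 2 ≤ (|K| + c) ^ 2 * p := by
  have hc := h.bound_nonneg
  have hp1 : (1 : ℝ) ≤ √(p : ℝ) := Real.one_le_sqrt.2 (by exact_mod_cast Nat.one_le_iff_ne_zero.2 hp)
  rw [← norm_sq_eq_sum_zeroExt]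
  have h1 : ‖coefDev μ PX θ‖ ≤ (|K| + c) * √(p : ℝ) := by
    refine (norm_sub_le _ _).trans ?_
    have h2 := norm_bestCoef_le (α := α) h
    have h3 : K * √(p : ℝ) ≤ |K| * √(p : ℝ) := by gcongr; exact le_abs_self K
    nlinarith
  refine (pow_le_pow_left₀ (norm_nonneg _) h1 2).trans_eq ?_
  rw [mul_pow, Real.sq_sqrt (Nat.cast_nonneg p)]

theorem empMean_sqLoss_observe (hn : n ≠ 0) (z : Fin n → (Fin p → ℝ) × ℝ)
    (θ : EuclideanSpace ℝ α) :
    empMean (fun i => observe μ (z i)) (fun x => sqLoss σ α x θ) + σ ^ 2 =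
      empMean z fun w => (approxErr μ PX w.1 + w.2 +
        ∑ j, (bestCoef μ PX j - zeroExt θ.ofLp j) * w.1 j) ^ 2 := by
  rw [← empMean_const (fun i => observe μ (z i)) hn (σ ^ 2), ← empMean_add]
  have : ∀ i, sqLoss σ α (observe μ (z i)) θ + σ ^ 2 = (approxErr μ PX (z i).1 + (z i).2 +
        ∑ j, (bestCoef μ PX j - zeroExt θ.ofLp j) * (z i).1 j) ^ 2 := fun i => by
    rw [sqLoss_observe σ μ PX, sub_add_cancel]
  simp only [empMean_eq, this]

theorem sum_coefDev_sq_le (h : IsBoundedDesign c σ PX Pε μ) (hn : n ≠ 0)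
    (hH : Metric.closedBall 0 c ⊆ H) (z : Fin n → (Fin p → ℝ) × ℝ)
    (hθ : IsMinLossEstimator (sqLoss σ α) H (fun i => observe μ (z i)) θ)
    (hA : ∑ j, ∑ k, gramErr z j k ^ 2 ≤ 1 / 4) :
    ∑ j, zeroExt (coefDev μ PX θ).ofLp j ^ 2 ≤
      48 * ∑ j, crossErr (approxErr μ PX) z j ^ 2 +
        24 * (modelMSE μ PX α * ∑ j, ∑ k, gramErr z j k ^ 2) := by
  have hmin := hθ.2 _ (hH (mem_closedBall_zero_iff.2 (norm_bestCoef_le (α := α) h)))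
  have hmin' := add_le_add_left hmin (σ ^ 2)
  rw [empMean_sqLoss_observe (PX := PX) hn, empMean_sqLoss_observe (PX := PX) hn] at hmin'
  simp only [coef_sub_zeroExt θ] at hmin'
  refine (sum_sq_le_of_empMean_le hn _ z _ _ (sum_coef_mul_coefDev θ) hmin' hA).trans ?_
  have hT : 0 ≤ ∑ j, ∑ k, gramErr z j k ^ 2 :=
    Finset.sum_nonneg fun _ _ => Finset.sum_nonneg fun _ _ => sq_nonneg _
  have h0 : 0 ≤ approxMSE μ PX := IsBoundedDesign.approxMSE_nonneg
  gcongr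
  exact le_add_of_nonneg_left h0

/-- The corrected loss of the estimator is, up to a term that does not depend on the model, close
to its prediction loss. -/
theorem abs_correctedLoss_sub_le (h : IsBoundedDesign c σ PX Pε μ) (hn : n ≠ 0)
    (hH : Metric.closedBall 0 c ⊆ H) (z : Fin n → (Fin p → ℝ) × ℝ)
    (hθ : IsMinLossEstimator (sqLoss σ α) H (fun i => observe μ (z i)) θ)
    (hz : ∀ i j, |(z i).1 j| ≤ c) {δ b : ℝ} (hδ : 0 < δ) (hδ2 : δ ≤ 1 / 2) (hb : 0 < b)
    (hbα : b ≤ modelMSE μ PX α)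
    (hT : ∑ j, ∑ k, gramErr z j k ^ 2 ≤ δ ^ 2)
    (hR : ∑ j, crossErr (approxErr μ PX) z j ^ 2 ≤ δ ^ 2 * b)
    (hB : baseErr μ PX z ^ 2 ≤ (δ * max b (approxMSE μ PX)) ^ 2)
    (hY : 4 * c ^ 2 * (p / n) * empMean z (fun w => (μ w.1 + w.2) ^ 2) ≤ δ * b) :
    |correctedLoss (sqLoss σ α) (fun i => observe μ (z i)) θ -
      (empMean z (fun w => w.2 ^ 2) - σ ^ 2) - predLoss (obsLaw μ PX Pε) (sqLoss σ α) θ| ≤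
      5 * δ * predLoss (obsLaw μ PX Pε) (sqLoss σ α) θ := by
  have hc := h.bound_nonneg
  have hT4 : ∑ j, ∑ k, gramErr z j k ^ 2 ≤ 1 / 4 := by nlinarith
  have hpen := penalty_bounds hn σ c μ z hz θ hT4
  have h0H : (0 : EuclideanSpace ℝ α) ∈ H := hH (by simpa using hc)
  have hmin := add_le_add_left (hθ.2 _ h0H) (σ ^ 2)
  have hzero : empMean (fun i => observe μ (z i)) (fun x => sqLoss σ α x 0) + σ ^ 2 =
      empMean z (fun w => (μ w.1 + w.2) ^ 2) := by
    rw [← empMean_const (fun i => observe μ (z i)) hn (σ ^ 2), ← empMean_add]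
    simp [empMean_eq, sqLoss, observe]
  rw [hzero] at hmin
  have hexp : empMean (fun i => observe μ (z i)) (fun x => sqLoss σ α x θ) + σ ^ 2 = _ :=
    (empMean_sqLoss_observe (PX := PX) hn z θ).trans (empMean_add_linear_sq hn _ z _)
  -- Isolates `E_n ε²`, the common shift of all criteria.
  have hbase : empMean z (fun w => (approxErr μ PX w.1 + w.2) ^ 2) =
      baseErr μ PX z + approxMSE μ PX + empMean z (fun w => w.2 ^ 2) := by
    rw [baseErr, ← empMean_const z hn (approxMSE μ PX), ← empMean_add, empMean_const z hn,
      ← empMean_add]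
    congr 1
    funext w
    ring
  have hL := predLoss_eq h (α := α) θ
  have hαL := modelMSE_le_predLoss h θ
  have hML : max b (approxMSE μ PX) ≤ predLoss (obsLaw μ PX Pε) (sqLoss σ α) θ :=
    max_le (hbα.trans hαL) (approxMSE_le_modelMSE.trans hαL)
  have hM0 : 0 < max b (approxMSE μ PX) := lt_max_of_lt_left hb
  have hB' := abs_le.1 (abs_le_of_sq_le_sq hB (by positivity))
  have hB0 : 0 ≤ approxMSE μ PX := IsBoundedDesign.approxMSE_nonneg
  have hbil := abs_le.1 (abs_bilin_self_le hδ.le hT fun j => bestCoef μ PX j - zeroExt θ.ofLp j)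
  have hcs := Finset.sum_mul_sq_le_sq_mul_sq Finset.univ
    (fun j => bestCoef μ PX j - zeroExt θ.ofLp j) (crossErr (approxErr μ PX) z)
  have hU : 0 ≤ ∑ j, (bestCoef μ PX j - zeroExt θ.ofLp j) ^ 2 :=
    Finset.sum_nonneg fun _ _ => sq_nonneg _
  rw [correctedLoss]
  set L := predLoss (obsLaw μ PX Pε) (sqLoss σ α) θ
  set U := ∑ j, (bestCoef μ PX j - zeroExt θ.ofLp j) ^ 2
  have hcross := abs_le.1 (abs_le_of_sq_le_sq (b := δ * L) (hcs.trans (by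
    have h1 : U ≤ L := by linarith
    have h2 : δ ^ 2 * b ≤ δ ^ 2 * L := by gcongr; linarith
    calc U * _ ≤ L * (δ ^ 2 * L) := mul_le_mul h1 (hR.trans h2)
          (Finset.sum_nonneg fun _ _ => sq_nonneg _) (by linarith)
      _ = _ := by ring)) (by have : 0 ≤ L := by linarith
                             positivity))
  have hn' : (0 : ℝ) < n := by positivity
  have hpen1 := mul_nonneg (inv_nonneg.2 hn'.le) hpen.1
  -- The residuals of the minimizer are no larger in mean square than those of `θ = 0`, which are
  -- the responses.
  have hpen2 : (n : ℝ)⁻¹ * ((Vhat (sqLoss σ α) (fun i => observe μ (z i)) θ)⁻¹ *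
      Jhat (sqLoss σ α) (fun i => observe μ (z i)) θ).trace ≤ δ * b := by
    refine le_trans (mul_le_mul_of_nonneg_left (hpen.2.trans
      (mul_le_mul_of_nonneg_left hmin (by positivity))) (inv_nonneg.2 hn'.le)) ?_
    refine le_trans (le_of_eq ?_) hY
    field_simp
  have hδb : δ * b ≤ δ * L := by gcongr; linarith
  have hδM : δ * max b (approxMSE μ PX) ≤ δ * L := by gcongr
  have hδU : δ * U ≤ δ * L := by gcongr; linarith
  rw [hbase] at hexp
  rw [abs_le]
  -- The five multiples of `δ L`: one each from `baseErr`, the quadratic form and the penalty, two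
  -- from the linear term.
  constructor <;> linarith [hB'.1, hB'.2, hbil.1, hbil.2, hcross.1, hcross.2]

end Model

/-! ### Risk bound and the probability of the exceptional event -/

section Risk

variable {Ω : Type*} [MeasurableSpace Ω] {P : Measure Ω} [IsProbabilityMeasure P]
  {p n : ℕ} {c σ : ℝ} {PX : Measure (Fin p → ℝ)} [IsProbabilityMeasure PX]
  {Pε : Measure ℝ} [IsProbabilityMeasure Pε] {μ : (Fin p → ℝ) → ℝ}
  {W : Fin n → Ω → (Fin p → ℝ) × ℝ} {α : Finset (Fin p)}

theorem integral_predLoss_le (h : IsBoundedDesign c σ PX Pε μ) (hn : n ≠ 0) (hp : p ≠ 0)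
    (hW : ∀ i, HasLaw (W i) (PX.prod Pε) P) (hind : iIndepFun W P)
    {H : Set (EuclideanSpace ℝ α)} (hH : Metric.closedBall 0 c ⊆ H) {K : ℝ}
    (hHK : H ⊆ Metric.closedBall 0 (K * √(p : ℝ))) {θhat : Ω → EuclideanSpace ℝ α}
    (hθ : ∀ ω, IsMinLossEstimator (sqLoss σ α) H (fun i => observe μ (W i ω)) (θhat ω)) :
    ∫ ω, predLoss (obsLaw μ PX Pε) (sqLoss σ α) (θhat ω) ∂P ≤
      modelMSE μ PX α * (1 + 24 * ((c ^ 2 + 1) ^ 2 * ((p : ℝ) ^ 2 / n))) +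
        48 * (c ^ 2 * (c ^ 2 + σ ^ 2) * ((p : ℝ) / n)) +
        (|K| + c) ^ 2 * p * (256 * (c ^ 2 + 1) ^ 4 * ((p : ℝ) ^ 6 / (n : ℝ) ^ 2)) := by
  have hM0 : 0 ≤ modelMSE μ PX α := IsBoundedDesign.approxMSE_nonneg.trans approxMSE_le_modelMSE
  set S := {ω | 1 / 4 < ∑ j, ∑ k, gramErr (fun i => W i ω) j k ^ 2} with hS
  -- A measurable hull of equal measure, to integrate an indicator.
  set S' := toMeasurable P S
  have hS'm : MeasurableSet S' := measurableSet_toMeasurable P S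
  have hSprob : P.real S' = P.real S := by simp only [measureReal_def, S', measure_toMeasurable]
  have hiT := h.integrable_gramErr_sq hW
  have hiR := h.integrable_crossErr_sq hW
  set A := (|K| + c) ^ 2 * p
  have hA : 0 ≤ A := by positivity
  have hiS : Integrable (S'.indicator fun _ => A) P := (integrable_const A).indicator hS'm
  have hpt : ∀ ω, predLoss (obsLaw μ PX Pε) (sqLoss σ α) (θhat ω) ≤
      modelMSE μ PX α + (48 * ∑ j, crossErr (approxErr μ PX) (fun i => W i ω) j ^ 2 +
        (24 * modelMSE μ PX α * ∑ j, ∑ k, gramErr (fun i => W i ω) j k ^ 2 +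
          S'.indicator (fun _ => A) ω)) := by
    intro ω
    rw [predLoss_eq_modelMSE_add h]
    have hT : 0 ≤ ∑ j, ∑ k, gramErr (fun i => W i ω) j k ^ 2 :=
      Finset.sum_nonneg fun _ _ => Finset.sum_nonneg fun _ _ => sq_nonneg _
    have hR : 0 ≤ ∑ j, crossErr (approxErr μ PX) (fun i => W i ω) j ^ 2 :=
      Finset.sum_nonneg fun _ _ => sq_nonneg _
    have hMT := mul_nonneg hM0 hT
    by_cases hω : ω ∈ S
    · rw [Set.indicator_of_mem (subset_toMeasurable P S hω)]
      have h1 := sum_coefDev_sq_le_of_bounded h hp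
        (mem_closedBall_zero_iff.1 (hHK (hθ ω).1))
      linarith
    · have h1 := sum_coefDev_sq_le h hn hH _ (hθ ω)
        (not_lt.1 fun hlt => hω (by rw [hS, Set.mem_ofPred_eq]; exact hlt))
      have h2 : 0 ≤ S'.indicator (fun _ => A) ω := Set.indicator_nonneg (fun _ _ => hA) ω
      linarith
  have hi1 : Integrable (fun ω => 24 * modelMSE μ PX α *
      ∑ j, ∑ k, gramErr (fun i => W i ω) j k ^ 2 + S'.indicator (fun _ => A) ω) P :=
    (hiT.const_mul _).add hiS
  have hi2 : Integrable (fun ω => 48 * ∑ j, crossErr (approxErr μ PX) (fun i => W i ω) j ^ 2 +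
      (24 * modelMSE μ PX α * ∑ j, ∑ k, gramErr (fun i => W i ω) j k ^ 2 +
        S'.indicator (fun _ => A) ω)) P := (hiR.const_mul _).add hi1
  -- Only the majorant has to be integrable.
  refine (integral_mono_of_nonneg
    (.of_forall fun ω => hM0.trans (modelMSE_le_predLoss h (θhat ω)))
    ((integrable_const (modelMSE μ PX α)).add hi2) (.of_forall hpt)).trans ?_
  simp only [Pi.add_apply]
  rw [integral_add (integrable_const _) hi2, integral_add (hiR.const_mul _) hi1,
    integral_add (hiT.const_mul _) hiS, integral_const_mul, integral_const_mul,
    integral_indicator_const _ hS'm, hSprob]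
  have b1 := h.integral_gramErr_sq_le hn hW hind
  have b2 := h.integral_crossErr_sq_le hn hW hind
  have b3 := h.measureReal_gramErr_gt_le hn hp hW hind
  have b1' := mul_le_mul_of_nonneg_left b1 (by positivity : 0 ≤ 24 * modelMSE μ PX α)
  have b3' := mul_le_mul_of_nonneg_right b3 hA
  simp only [integral_const, probReal_univ, smul_eq_mul, one_mul]
  linarith

theorem measureReal_lt_le_div {f : Ω → ℝ} (hf : ∀ ω, 0 ≤ f ω) (hi : Integrable f P) {t B : ℝ}
    (ht : 0 < t) (hB : ∫ ω, f ω ∂P ≤ B) : P.real {ω | t < f ω} ≤ B / t := by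
  rw [le_div_iff₀ ht, mul_comm]
  refine le_trans ?_ ((mul_meas_ge_le_integral_of_nonneg (.of_forall hf) hi t).trans hB)
  refine mul_le_mul_of_nonneg_left (measureReal_mono (fun ω hω => ?_)) ht.le
  rw [Set.mem_ofPred_eq] at hω ⊢
  exact hω.le

/-- The event on which the corrected loss is uniformly close to the prediction loss. -/
def goodEvent (c : ℝ) (μ : (Fin p → ℝ) → ℝ) (PX : Measure (Fin p → ℝ))
    (W : Fin n → Ω → (Fin p → ℝ) × ℝ) (δ b : ℝ) : Set Ω :=
  {ω | (∀ i j, |(W i ω).1 j| ≤ c) ∧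
    ∑ j, ∑ k, gramErr (fun i => W i ω) j k ^ 2 ≤ δ ^ 2 ∧
    ∑ j, crossErr (approxErr μ PX) (fun i => W i ω) j ^ 2 ≤ δ ^ 2 * b ∧
    baseErr μ PX (fun i => W i ω) ^ 2 ≤ (δ * max b (approxMSE μ PX)) ^ 2 ∧
    4 * c ^ 2 * (p / n) * empMean (fun i => W i ω) (fun w => (μ w.1 + w.2) ^ 2) ≤ δ * b}

theorem measureReal_compl_goodEvent_le (h : IsBoundedDesign c σ PX Pε μ) (hn : n ≠ 0)
    (hp : p ≠ 0) (hW : ∀ i, HasLaw (W i) (PX.prod Pε) P) (hind : iIndepFun W P) {δ b : ℝ}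
    (hδ : 0 < δ) (hδ1 : δ ≤ 1) (hb : 0 < b) :
    P.real (goodEvent c μ PX W δ b)ᶜ ≤
      ((c ^ 2 + 1) ^ 2 * ((p : ℝ) ^ 2 / n) + (c ^ 2 * (c ^ 2 + σ ^ 2) +
        (2 * c ^ 2 + 2 * c ^ 4 + 4 * σ ^ 2) + 4 * c ^ 2 * (c ^ 2 + σ ^ 2)) * (p / n / b)) /
        δ ^ 2 := by
  have hp1 : (1 : ℝ) ≤ p := by exact_mod_cast Nat.one_le_iff_ne_zero.2 hp
  have hn' : (0 : ℝ) < n := by positivity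
  set m := max b (approxMSE μ PX)
  have hm : 0 < m := lt_max_of_lt_left hb
  have hae : P.real {ω | ¬ ∀ i j, |(W i ω).1 j| ≤ c} = 0 := by
    rw [measureReal_eq_zero_iff]
    have : ∀ᵐ ω ∂P, ∀ i j, |(W i ω).1 j| ≤ c := by
      refine ae_all_iff.2 fun i => ae_all_iff.2 fun j => ?_
      exact ae_comp_hasLaw (q := fun w => |w.1 j| ≤ c) (hW i)
        (IsBoundedDesign.ae_fst (h.abs_coord_le j))
    exact this
  have h1 := measureReal_lt_le_div (fun ω => Finset.sum_nonneg fun _ _ =>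
    Finset.sum_nonneg fun _ _ => sq_nonneg _) (h.integrable_gramErr_sq hW)
    (t := δ ^ 2) (by positivity) (h.integral_gramErr_sq_le hn hW hind)
  have h2 := measureReal_lt_le_div (fun ω => Finset.sum_nonneg fun _ _ => sq_nonneg _)
    (h.integrable_crossErr_sq hW)
    (t := δ ^ 2 * b) (by positivity) (h.integral_crossErr_sq_le hn hW hind)
  have h3 := measureReal_lt_le_div (fun ω => sq_nonneg _) (h.integrable_baseErr_sq hW)
    (t := (δ * m) ^ 2) (by positivity) (h.integral_baseErr_sq_le hn hW hind)
  have h4 := measureReal_lt_le_div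
    (f := fun ω => 4 * c ^ 2 * (p / n) * empMean (fun i => W i ω) (fun w => (μ w.1 + w.2) ^ 2))
    (fun ω => mul_nonneg (by positivity) (empMean_nonneg _ fun i => sq_nonneg _))
    ((h.integrable_empMean_response_sq hW).const_mul _) (t := δ * b) (by positivity)
    (B := 4 * c ^ 2 * (p / n) * (c ^ 2 + σ ^ 2)) (by
      rw [integral_const_mul]
      exact mul_le_mul_of_nonneg_left (h.integral_empMean_response_sq_le hn hW) (by positivity))
  have hsub : (goodEvent c μ PX W δ b)ᶜ ⊆
      {ω | ¬ ∀ i j, |(W i ω).1 j| ≤ c} ∪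
      ({ω | δ ^ 2 < ∑ j, ∑ k, gramErr (fun i => W i ω) j k ^ 2} ∪
      ({ω | δ ^ 2 * b < ∑ j, crossErr (approxErr μ PX) (fun i => W i ω) j ^ 2} ∪
      ({ω | (δ * m) ^ 2 < baseErr μ PX (fun i => W i ω) ^ 2} ∪
      {ω | δ * b < 4 * c ^ 2 * (p / n) *
        empMean (fun i => W i ω) (fun w => (μ w.1 + w.2) ^ 2)}))) := by
    intro ω hω
    simp only [goodEvent, Set.mem_compl_iff, Set.mem_ofPred_eq, Set.mem_union] at hω ⊢
    simp only [← not_le]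
    tauto
  have hbound := (measureReal_mono hsub (measure_ne_top P _)).trans
    ((measureReal_union_le _ _).trans (add_le_add_right ((measureReal_union_le _ _).trans
      (add_le_add_right ((measureReal_union_le _ _).trans
        (add_le_add_right (measureReal_union_le _ _) _)) _)) _))
  have e3 : (2 * c ^ 2 + 2 * c ^ 4 * p + 4 * σ ^ 2) * approxMSE μ PX / n / (δ * m) ^ 2 ≤
      (2 * c ^ 2 + 2 * c ^ 4 + 4 * σ ^ 2) * (p / n / b) / δ ^ 2 := by
    have hc1 : 2 * c ^ 2 + 2 * c ^ 4 * p + 4 * σ ^ 2 ≤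
        (2 * c ^ 2 + 2 * c ^ 4 + 4 * σ ^ 2) * p := by
      nlinarith [sq_nonneg c, sq_nonneg σ]
    -- One factor `m` absorbs `approxMSE`, the other is at least `b`; this is why the threshold for
    -- `baseErr` uses their maximum.
    have hc2 : approxMSE μ PX / m ^ 2 ≤ 1 / b := by
      rw [div_le_div_iff₀ (by positivity) hb, one_mul, pow_two]
      exact mul_le_mul (le_max_right _ _) (le_max_left _ _) hb.le hm.le
    calc _ = (2 * c ^ 2 + 2 * c ^ 4 * p + 4 * σ ^ 2) * (approxMSE μ PX / m ^ 2) / n / δ ^ 2 := by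
          field_simp
      _ ≤ ((2 * c ^ 2 + 2 * c ^ 4 + 4 * σ ^ 2) * p) * (1 / b) / n / δ ^ 2 := by
          have := mul_le_mul hc1 hc2
            (div_nonneg IsBoundedDesign.approxMSE_nonneg (by positivity)) (by positivity)
          gcongr
      _ = _ := by field_simp
  have e4 : 4 * c ^ 2 * (p / n) * (c ^ 2 + σ ^ 2) / (δ * b) ≤
      4 * c ^ 2 * (c ^ 2 + σ ^ 2) * (p / n / b) / δ ^ 2 := by
    calc _ = 4 * c ^ 2 * (c ^ 2 + σ ^ 2) * (p / n / b) / δ := by field_simp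
      _ ≤ _ := by
        refine div_le_div_of_nonneg_left (by positivity) (by positivity) ?_
        nlinarith
  have e2 : c ^ 2 * (c ^ 2 + σ ^ 2) * ((p : ℝ) / n) / (δ ^ 2 * b) =
      c ^ 2 * (c ^ 2 + σ ^ 2) * (p / n / b) / δ ^ 2 := by field_simp
  have : ((c ^ 2 + 1) ^ 2 * ((p : ℝ) ^ 2 / n) + (c ^ 2 * (c ^ 2 + σ ^ 2) +
        (2 * c ^ 2 + 2 * c ^ 4 + 4 * σ ^ 2) + 4 * c ^ 2 * (c ^ 2 + σ ^ 2)) * (p / n / b)) /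
        δ ^ 2 = (c ^ 2 + 1) ^ 2 * ((p : ℝ) ^ 2 / n) / δ ^ 2 +
      (c ^ 2 * (c ^ 2 + σ ^ 2) * (p / n / b) / δ ^ 2 +
      ((2 * c ^ 2 + 2 * c ^ 4 + 4 * σ ^ 2) * (p / n / b) / δ ^ 2 +
        4 * c ^ 2 * (c ^ 2 + σ ^ 2) * (p / n / b) / δ ^ 2)) := by ring
  rw [this]
  rw [hae] at hbound
  linarith

end Risk

/-- If a criterion is, up to a constant, uniformly close to positive losses relative to their size,
then the loss of the selected model is close to the smallest loss. -/
theorem abs_ratio_sub_one_le {A : Type*} {M : Finset A} (hM : M.Nonempty) {crit L : A → ℝ}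
    {e δ : ℝ} (hδ : δ ≤ 1 / 10) (hL : ∀ α ∈ M, 0 < L α)
    (hclose : ∀ α ∈ M, |crit α - e - L α| ≤ 5 * δ * L α) {a : A} (ha : IsSelected M crit a) :
    |L a / M.inf' hM L - 1| ≤ 20 * δ := by
  obtain ⟨a₀, ha₀, heq⟩ := M.exists_mem_eq_inf' hM L
  have hle : M.inf' hM L ≤ L a := M.inf'_le L ha.1
  rw [heq] at hle ⊢
  have h0 := hL a₀ ha₀
  have h1 := abs_le.1 (hclose a ha.1)
  have h2 := abs_le.1 (hclose a₀ ha₀)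
  have h3 := ha.2 a₀ ha₀
  -- Optimality gives `(1 - 5δ) L a ≤ (1 + 5δ) L a₀`, and `(1 + 5δ)/(1 - 5δ) ≤ 1 + 20δ` for `0 ≤ δ ≤
  -- 1/10`.
  have h4 : L a ≤ (1 + 20 * δ) * L a₀ := by
    by_contra! hlt
    have := hL a ha.1
    nlinarith [h1.1, h2.2]
  have h5 : 1 ≤ L a / L a₀ := (one_le_div h0).2 hle
  have h6 : L a / L a₀ ≤ 1 + 20 * δ := (div_le_iff₀ h0).2 h4
  rw [abs_of_nonneg (by linarith)]
  linarith

/-! ### Growth rates -/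

theorem tendsto_pow_mul_rpow {p : ℕ → ℕ} {w s : ℝ} (k : ℕ)
    (hp : (fun n => (p n : ℝ)) =o[atTop] fun n : ℕ => (n : ℝ) ^ w) (hs : k * w + s < 0) :
    Tendsto (fun n : ℕ => (p n : ℝ) ^ k * (n : ℝ) ^ s) atTop (𝓝 0) := by
  have hlim : Tendsto (fun n : ℕ => (n : ℝ) ^ (k * w + s)) atTop (𝓝 0) := by
    have := (tendsto_rpow_neg_atTop (y := -(k * w + s)) (by linarith)).comp
      tendsto_natCast_atTop_atTop
    simpa [Function.comp_def] using this
  refine squeeze_zero' (.of_forall fun n => by positivity) ?_ hlim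
  filter_upwards [hp.bound one_pos, eventually_gt_atTop 0] with n hn hn0
  have hn' : (0 : ℝ) < n := by exact_mod_cast hn0
  rw [one_mul, Real.norm_of_nonneg (by positivity), Real.norm_of_nonneg (by positivity)] at hn
  calc _ ≤ ((n : ℝ) ^ w) ^ k * (n : ℝ) ^ s := by gcongr
    _ = _ := by
      rw [← Real.rpow_natCast, ← Real.rpow_mul hn'.le, ← Real.rpow_add hn', mul_comm w]

theorem approxMSE_eq_zero {p : ℕ} {PX : Measure (Fin p → ℝ)} [IsProbabilityMeasure PX]
    {μ : (Fin p → ℝ) → ℝ} (hp : p = 0) (h0 : ∫ x, μ x ∂PX = 0) : approxMSE μ PX = 0 := by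
  subst hp
  have hconst : ∀ x, μ x = μ 0 := fun x => congrArg μ (Subsingleton.elim x 0)
  have hz : μ 0 = 0 := by simpa [hconst] using h0
  have : ∀ x, approxErr μ PX x = 0 := fun x => by
    rw [approxErr, hconst x, hz]
    simp
  simp [approxMSE, this]

theorem isBoundedDesign_of_iIndepFun {p : ℕ} {c σ : ℝ} {PX : Measure (Fin p → ℝ)}
    [IsProbabilityMeasure PX] {Pε : Measure ℝ} [IsProbabilityMeasure Pε]
    {μ : (Fin p → ℝ) → ℝ} (hμ : Measurable μ) (hε2 : MemLp id 2 Pε) (hε0 : ∫ e, e ∂Pε = 0)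
    (hεσ : Var[id; Pε] = σ ^ 2) (hμc : ∀ᵐ x ∂PX, |μ x| ≤ c) (hXc : ∀ j, ∀ᵐ x ∂PX, |x j| ≤ c)
    (hXindep : iIndepFun (fun (j : Fin p) (x : Fin p → ℝ) => x j) PX)
    (hX0 : ∀ j, ∫ x, x j ∂PX = 0) (hX1 : ∀ j, Var[fun x => x j; PX] = 1) :
    IsBoundedDesign c σ PX Pε μ where
  measurable := hμ
  memLp_noise := hε2
  integral_noise := hε0
  integral_noise_sq := by
    rw [← hεσ, variance_of_integral_eq_zero aemeasurable_id (by simpa using hε0)]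
    rfl
  abs_regr_le := hμc
  abs_coord_le := hXc
  integral_coord_mul := by
    intro j k
    split_ifs with hjk
    · subst hjk
      rw [← hX1 j, variance_of_integral_eq_zero (measurable_pi_apply j).aemeasurable (hX0 j)]
      simp only [pow_two]
    · have := (hXindep.indepFun hjk).integral_fun_mul_eq_mul_integral
        (measurable_pi_apply j).aestronglyMeasurable (measurable_pi_apply k).aestronglyMeasurable
      rw [this, hX0, zero_mul]

end GTIC

/-! ### Assembly: the growth conditions and convergence in probability. -/

theorem corollary1
    {Ω : Type*} [MeasurableSpace Ω] (P : Measure Ω) [IsProbabilityMeasure P]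
    -- the population: covariates, noise and regression function for each sample size
    (p : ℕ → ℕ) (c σ : ℝ)
    (PX : ∀ n, Measure (Fin (p n) → ℝ)) [∀ n, IsProbabilityMeasure (PX n)]
    (Pε : ℕ → Measure ℝ) [∀ n, IsProbabilityMeasure (Pε n)]
    (μ : ∀ n, (Fin (p n) → ℝ) → ℝ) (hμ : ∀ n, Measurable (μ n))
    -- the noise has mean zero and variance `σ²`, and the response has mean zero
    (hε2 : ∀ n, MemLp id 2 (Pε n)) (hε0 : ∀ n, ∫ e, e ∂(Pε n) = 0)
    (hεσ : ∀ n, Var[id; Pε n] = σ ^ 2)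
    (hμ0 : ∀ n, ∫ x, μ n x ∂(PX n) = 0)
    -- `|μ|` and `|X_j|` are bounded by `c`
    (hμc : ∀ n, ∀ᵐ x ∂(PX n), |μ n x| ≤ c)
    (hXc : ∀ n, ∀ j, ∀ᵐ x ∂(PX n), |x j| ≤ c)
    -- the covariates are independent with zero mean and unit variance
    (hXindep : ∀ n, iIndepFun (fun (j : Fin (p n)) (x : Fin (p n) → ℝ) => x j) (PX n))
    (hX0 : ∀ n, ∀ j, ∫ x, x j ∂(PX n) = 0)
    (hX1 : ∀ n, ∀ j, Var[fun x => x j; PX n] = 1)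
    -- the data: for each `n`, independent copies of the covariates and the noise
    (X : ∀ n, Fin n → Ω → Fin (p n) → ℝ) (ε : ∀ n, Fin n → Ω → ℝ)
    (hlaw : ∀ n i, HasLaw (fun ω => (X n i ω, ε n i ω)) ((PX n).prod (Pε n)) P)
    (hindep : ∀ n, iIndepFun (fun i ω => (X n i ω, ε n i ω)) P)
    -- the model class
    (M : ∀ n, Finset (Finset (Fin (p n)))) (hM : ∀ n, (M n).Nonempty)
    -- the compact parameter spaces
    (K : ℝ) (H : ∀ n, ∀ α : Finset (Fin (p n)), Set (EuclideanSpace ℝ α))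
    (hHcomp : ∀ n, ∀ α ∈ M n, IsCompact (H n α))
    (hHlower : ∀ n, ∀ α ∈ M n, Metric.closedBall 0 c ⊆ H n α)
    (hHupper : ∀ n, ∀ α ∈ M n, H n α ⊆ Metric.closedBall 0 (K * √(p n : ℝ)))
    -- the minimum loss estimators
    (θhat : ∀ n, ∀ α : Finset (Fin (p n)), Ω → EuclideanSpace ℝ α)
    (hθmeas : ∀ n, ∀ α ∈ M n, Measurable (θhat n α))
    (hθ : ∀ n, ∀ α ∈ M n, ∀ ω, GTIC.IsMinLossEstimator (GTIC.sqLoss σ α) (H n α)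
      (fun i => GTIC.observe (μ n) (X n i ω, ε n i ω)) (θhat n α ω))
    -- the model selected by the GTIC procedure
    (αhat : ∀ n, Ω → Finset (Fin (p n)))
    (hα : ∀ n ω, GTIC.IsSelected (M n)
      (fun α => GTIC.correctedLoss (GTIC.sqLoss σ α)
        (fun i => GTIC.observe (μ n) (X n i ω, ε n i ω)) (θhat n α ω)) (αhat n ω))
    -- the growth conditions
    (w ζ ν : ℝ)
    (hw : w < 1 / 8) (hp : (fun n => (p n : ℝ)) =o[atTop] fun n : ℕ => (n : ℝ) ^ w)
    (hζ : ζ < 1 - 2 * w)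
    (hR : ∀ᶠ n : ℕ in atTop, ∀ α ∈ M n,
      (n : ℝ) ^ (-ζ) <
        ∫ ω, GTIC.predLoss (GTIC.obsLaw (μ n) (PX n) (Pε n)) (GTIC.sqLoss σ α) (θhat n α ω) ∂P)
    (hν : ν < 1 / 2 - 4 * w)
    (hcard : (fun n => ((M n).card : ℝ)) =O[atTop] fun n : ℕ => (n : ℝ) ^ ν) :
    GTIC.AsymptoticallyEfficient P M hM
      (fun n α ω =>
        GTIC.predLoss (GTIC.obsLaw (μ n) (PX n) (Pε n)) (GTIC.sqLoss σ α) (θhat n α ω))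
      αhat := by
  have hD : ∀ n, GTIC.IsBoundedDesign c σ (PX n) (Pε n) (μ n) := fun n =>
    GTIC.isBoundedDesign_of_iIndepFun (hμ n) (hε2 n) (hε0 n) (hεσ n) (hμc n) (hXc n) (hXindep n)
      (hX0 n) (hX1 n)
  -- `hρ` is `p²/n = o(n^(-ζ))`; `hτ` controls the Gram error; `hκ` times `hρ` handles the term
  -- `p⁷/n²` of the risk bound.
  have hρ := GTIC.tendsto_pow_mul_rpow (s := ζ - 1) 2 hp (by push_cast; linarith)
  have hτ := GTIC.tendsto_pow_mul_rpow (s := -1) 2 hp (by push_cast; linarith)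
  have hκ := GTIC.tendsto_pow_mul_rpow (s := -1) 5 hp (by push_cast; linarith)
  set A₁ := 48 * (c ^ 2 * (c ^ 2 + σ ^ 2))
  set A₂ := (|K| + c) ^ 2 * (256 * (c ^ 2 + 1) ^ 4)
  have hA₁ : 0 ≤ A₁ := by positivity
  -- Without covariates `μ` is a constant of mean zero, so the risk vanishes, contrary to its
  -- positive lower bound.
  have hpos : ∀ᶠ n in atTop, n ≠ 0 ∧ p n ≠ 0 := by
    filter_upwards [hR, eventually_gt_atTop 0] with n hn hn0
    refine ⟨hn0.ne', fun hp0 => ?_⟩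
    obtain ⟨α, hα'⟩ := hM n
    have h1 := hn α hα'
    have : IsEmpty (Fin (p n)) := by rw [hp0]; infer_instance
    simp only [GTIC.predLoss_eq (hD n), GTIC.approxMSE_eq_zero hp0 (hμ0 n),
      Finset.univ_eq_empty, Finset.sum_empty, add_zero, integral_zero] at h1
    exact absurd h1 (not_lt.2 (by positivity))
  -- the prediction losses are bounded below by a multiple of `n ^ (-ζ)`
  have hlow : ∀ᶠ n : ℕ in atTop, ∀ α ∈ M n,
      (n : ℝ) ^ (-ζ) / 4 ≤ GTIC.modelMSE (μ n) (PX n) α := by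
    have hy : Tendsto (fun n : ℕ => A₁ * ((p n : ℝ) ^ 2 * (n : ℝ) ^ (ζ - 1)) +
        A₂ * (((p n : ℝ) ^ 2 * (n : ℝ) ^ (ζ - 1)) * ((p n : ℝ) ^ 5 * (n : ℝ) ^ (-1 : ℝ))))
        atTop (𝓝 0) := by
      simpa using (hρ.const_mul A₁).add ((hρ.mul hκ).const_mul A₂)
    have hx : Tendsto (fun n : ℕ => 24 * (c ^ 2 + 1) ^ 2 *
        ((p n : ℝ) ^ 2 * (n : ℝ) ^ (-1 : ℝ))) atTop (𝓝 0) := by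
      simpa using hτ.const_mul (24 * (c ^ 2 + 1) ^ 2)
    filter_upwards [hpos, hR, hy.eventually_le_const (u := 1 / 2) (by norm_num),
      hx.eventually_le_const (u := 1) one_pos] with n ⟨hn0, hp0⟩ hRn hyn hxn α hαM
    have hn' : (0 : ℝ) < n := by positivity
    have hp1 : (1 : ℝ) ≤ p n := by exact_mod_cast Nat.one_le_iff_ne_zero.2 hp0
    have hrisk := (hRn α hαM).trans_le (GTIC.integral_predLoss_le (hD n) hn0 hp0 (hlaw n)
      (hindep n) (hHlower n α hαM) (hHupper n α hαM) (hθ n α hαM))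
    have hq : 0 < (n : ℝ) ^ (-ζ) := by positivity
    have hqn : (n : ℝ) ^ (ζ - 1) * (n : ℝ) ^ (-ζ) = (n : ℝ)⁻¹ := by
      rw [← Real.rpow_add hn', ← Real.rpow_neg_one]
      congr 1
      ring
    rw [Real.rpow_neg_one] at hyn hxn
    have hyq := mul_le_mul_of_nonneg_right hyn hq.le
    have e1 : (A₁ * ((p n : ℝ) ^ 2 * (n : ℝ) ^ (ζ - 1)) +
        A₂ * (((p n : ℝ) ^ 2 * (n : ℝ) ^ (ζ - 1)) * ((p n : ℝ) ^ 5 * (n : ℝ)⁻¹))) *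
          (n : ℝ) ^ (-ζ) = A₁ * ((p n : ℝ) ^ 2 * (n : ℝ)⁻¹) +
        A₂ * ((p n : ℝ) ^ 7 * (n : ℝ)⁻¹ ^ 2) := by
      linear_combination (A₁ * (p n : ℝ) ^ 2 + A₂ * (p n : ℝ) ^ 7 * (n : ℝ)⁻¹) * hqn
    have e2 : 48 * (c ^ 2 * (c ^ 2 + σ ^ 2) * ((p n : ℝ) / n)) ≤
        A₁ * ((p n : ℝ) ^ 2 * (n : ℝ)⁻¹) := by
      rw [div_eq_mul_inv, ← mul_assoc]
      refine mul_le_mul_of_nonneg_left (mul_le_mul_of_nonneg_right ?_ (by positivity)) hA₁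
      nlinarith
    have e3 : (|K| + c) ^ 2 * p n * (256 * (c ^ 2 + 1) ^ 4 * ((p n : ℝ) ^ 6 / (n : ℝ) ^ 2)) =
        A₂ * ((p n : ℝ) ^ 7 * (n : ℝ)⁻¹ ^ 2) := by
      simp only [A₂, div_eq_mul_inv, inv_pow]
      ring
    have e4 : GTIC.modelMSE (μ n) (PX n) α *
        (1 + 24 * ((c ^ 2 + 1) ^ 2 * ((p n : ℝ) ^ 2 / n))) ≤
        GTIC.modelMSE (μ n) (PX n) α * 2 := by
      refine mul_le_mul_of_nonneg_left ?_
        (GTIC.IsBoundedDesign.approxMSE_nonneg.trans GTIC.approxMSE_le_modelMSE)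
      rw [div_eq_mul_inv]
      linarith
    -- With `q = n^(-ζ)` the risk bound reads `q < 2 modelMSE + q/2`.
    linarith
  -- the exceptional event has small probability
  rw [GTIC.AsymptoticallyEfficient, tendstoInMeasure_iff_norm]
  intro η hη
  -- `1/10` is required by the ratio bound; `η/40` makes `20δ` strictly less than `η`.
  set δ := min (1 / 10) (η / 40)
  have hδ : 0 < δ := lt_min (by norm_num) (by linarith)
  have hδ10 : δ ≤ 1 / 10 := min_le_left _ _
  have hδη : 20 * δ < η := by
    have : δ ≤ η / 40 := min_le_right _ _
    linarith
  set A₃ := c ^ 2 * (c ^ 2 + σ ^ 2) + (2 * c ^ 2 + 2 * c ^ 4 + 4 * σ ^ 2) +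
    4 * c ^ 2 * (c ^ 2 + σ ^ 2)
  have hA₃ : 0 ≤ A₃ := by positivity
  have hbound : Tendsto (fun n : ℕ => ENNReal.ofReal
      (((c ^ 2 + 1) ^ 2 * ((p n : ℝ) ^ 2 * (n : ℝ) ^ (-1 : ℝ)) +
        A₃ * (4 * ((p n : ℝ) ^ 2 * (n : ℝ) ^ (ζ - 1)))) / δ ^ 2)) atTop (𝓝 0) := by
    rw [← ENNReal.ofReal_zero]
    refine ENNReal.tendsto_ofReal ?_
    simpa using ((hτ.const_mul ((c ^ 2 + 1) ^ 2)).add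
      ((hρ.const_mul 4).const_mul A₃)).div_const (δ ^ 2)
  refine tendsto_of_tendsto_of_tendsto_of_le_of_le' tendsto_const_nhds hbound
    (.of_forall fun n => zero_le) ?_
  filter_upwards [hpos, hlow] with n ⟨hn0, hp0⟩ hlown
  have hn' : (0 : ℝ) < n := by positivity
  have hp1 : (1 : ℝ) ≤ p n := by exact_mod_cast Nat.one_le_iff_ne_zero.2 hp0
  set b := (n : ℝ) ^ (-ζ) / 4 with hb
  have hb0 : 0 < b := by positivity
  set G := GTIC.goodEvent c (μ n) (PX n) (fun i ω => (X n i ω, ε n i ω)) δ b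
  refine (measure_mono (t := Gᶜ) fun ω hω hG => ?_).trans ?_
  · obtain ⟨hz, hT, hRr, hB, hY⟩ := hG
    rw [Set.mem_ofPred_eq, Real.norm_eq_abs] at hω
    have hratio := GTIC.abs_ratio_sub_one_le (hM n) hδ10
      (L := fun α => GTIC.predLoss (GTIC.obsLaw (μ n) (PX n) (Pε n)) (GTIC.sqLoss σ α)
        (θhat n α ω))
      (fun α hαM => hb0.trans_le ((hlown α hαM).trans
        (GTIC.modelMSE_le_predLoss (hD n) (θhat n α ω))))
      (fun α hαM => GTIC.abs_correctedLoss_sub_le (hD n) hn0 (hHlower n α hαM)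
        (fun i => (X n i ω, ε n i ω)) (hθ n α hαM ω) hz hδ (by linarith) hb0 (hlown α hαM)
        hT hRr hB hY) (hα n ω)
    linarith
  · rw [← ofReal_measureReal]
    refine ENNReal.ofReal_le_ofReal ((GTIC.measureReal_compl_goodEvent_le (hD n) hn0 hp0
      (hlaw n) (hindep n) hδ (by linarith) hb0).trans ?_)
    have e1 : (p n : ℝ) / n / b ≤ 4 * ((p n : ℝ) ^ 2 * (n : ℝ) ^ (ζ - 1)) := by
      have : (p n : ℝ) / n / b = 4 * (p n * (n : ℝ) ^ (ζ - 1)) := by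
        rw [hb, Real.rpow_sub_one hn'.ne', Real.rpow_neg hn'.le]
        field_simp
      rw [this]
      have : (p n : ℝ) ≤ (p n : ℝ) ^ 2 := by nlinarith
      gcongr
    rw [Real.rpow_neg_one, ← div_eq_mul_inv]
    gcongr
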